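/- Let $M$ be a smooth ($C^\infty$) finite-dimensional manifold without boundary, equipped with a smooth action of the circle group $S^1$. For a subgroup $\Gamma\subseteq S^1$, the connected components of the set of points of $M$ whose stabilizer is exactly $\Gamma$ are called \emph{orbit type strata}; write $\operatorname{Stab}(X)$ for the common stabilizer of the points of a stratum $X$. If $X$ is a stratum and $A\supseteq X$ is $M$ or the closure of another stratum, the normal bundle of $X$ in $A$ is $TA|_X/TX$, with the $S^1$-action induced by the differential of the action on $M$; an \emph{equivariant fiberwise complex structure} on it is a smooth $S^1$-equivariant bundle endomorphism $J$ (over the identity of $X$) with $J^2=-1$. Consider the following two conditions on $M$. (Bundle complex) The normal bundle in $M$ of every orbit type stratum admits an equivariant fiberwise complex structure. (Restriction) Whenever an orbit type stratum $X$ is contained in the closure of another orbit type stratum $Y$ and $[\operatorname{Stab}(X):\operatorname{Stab}(Y)]=2$, the normal bundle of $X$ in the closure of $Y$ admits an equivariant fiberwise complex structure. If $M$ satisfies (Restriction), then $M$ satisfies (Bundle complex). -/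

import Mathlib

open scoped Manifold ContDiff Topology

noncomputable section

namespace CircleManifold

/-! ### Tangent spaces of subsets -/

section Tangent

variable (E : Type*) [NormedAddCommGroup E] [NormedSpace ℝ E]
  {M : Type*} [TopologicalSpace M] [ChartedSpace E M]

/-- `v` is the velocity at time `0` of a smooth curve through `x` that stays in `A`
(the curve only matters near time `0`). -/
def IsVelocityIn (A : Set M) (x : M) (v : TangentSpace 𝓘(ℝ, E) x) : Prop :=
  ∃ γ : ℝ → M, γ 0 = x ∧
    (∀ᶠ t in 𝓝 (0 : ℝ), γ t ∈ A ∧ ContMDiffAt 𝓘(ℝ, ℝ) 𝓘(ℝ, E) ∞ γ t) ∧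
    (mfderiv 𝓘(ℝ, ℝ) 𝓘(ℝ, E) γ 0 (1 : ℝ) : E) = v

/-- The tangent space at `x` of a subset `A` of the manifold `M`, as a subspace of `T_x M`: the span
of the velocities of smooth curves in `A` through `x`. When `A` is near `x` an embedded submanifold,
this is its usual tangent space. -/
def tangentTo (A : Set M) (x : M) : Submodule ℝ (TangentSpace 𝓘(ℝ, E) x) :=
  Submodule.span ℝ {v | IsVelocityIn E A x v}

/-- The fibre at `x` of the normal bundle `TA|_X / TX` of `X` in `A`, for `X ⊆ A`. -/
abbrev NormalSpace (A X : Set M) (x : M) : Type _ :=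
  ↥(tangentTo E A x) ⧸ (tangentTo E X x).submoduleOf (tangentTo E A x)

/-- A section `s` of the normal bundle of `X` in `A` is smooth on the open part `X ∩ O` of `X` if
locally it is the class of a smooth vector field along `X` with values in `TA`. (For an embedded
submanifold `X`, `ContMDiffOn` on `X ∩ O'` is smoothness as a map on the manifold `X ∩ O'`.)
The values of `s` outside `X ∩ O` are irrelevant. -/
def IsSmoothNormalSectionOn [IsManifold 𝓘(ℝ, E) ∞ M] (A X O : Set M) (s : ∀ x : M, NormalSpace E A X x) : Prop :=
  ∀ x ∈ X ∩ O, ∃ O' : Set M, IsOpen O' ∧ x ∈ O' ∧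
    ∃ w : ∀ y : M, tangentTo E A y,
      ContMDiffOn 𝓘(ℝ, E) 𝓘(ℝ, E).tangent ∞
        (fun y : M => (⟨y, (w y : TangentSpace 𝓘(ℝ, E) y)⟩ : TangentBundle 𝓘(ℝ, E) M))
        (X ∩ O') ∧
      ∀ y ∈ X ∩ O', s y = Submodule.Quotient.mk (w y)

end Tangent

/-! ### Orbit type strata -/

section Strata

variable {M : Type*} [TopologicalSpace M] [MulAction Circle M] [ContinuousSMul Circle M]

/-- The orbit type stratum through `x`: the connected component containing `x` of the set of points
whose stabilizer is that of `x`. It is an invariant set. All strata are of this form. -/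
def orbitTypeStratum (x : M) : SubMulAction Circle M where
  carrier := connectedComponentIn
    {y : M | MulAction.stabilizer Circle y = MulAction.stabilizer Circle x} x
  smul_mem' := by
    intro g y hy
    have hyF := connectedComponentIn_subset _ _ hy
    rw [connectedComponentIn_eq hy]
    have hr : Set.range (fun h : Circle => h • y) ⊆ connectedComponentIn
        {z : M | MulAction.stabilizer Circle z = MulAction.stabilizer Circle x} y := by
      refine IsPreconnected.subset_connectedComponentIn ?_ ⟨1, one_smul _ _⟩ ?_
      · exact isPreconnected_range (by fun_prop)
      · rintro _ ⟨h, rfl⟩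
        exact (MulAction.stabilizer_smul_eq_right h y).trans hyF
    exact hr ⟨g, rfl⟩

/-- The closure of an invariant set, as an invariant set. -/
def invClosure (A : SubMulAction Circle M) : SubMulAction Circle M where
  carrier := closure (A : Set M)
  smul_mem' := fun g _ hx =>
    map_mem_closure (continuous_const_smul g) hx fun _ ha => A.smul_mem g ha

end Strata

/-! ### Equivariant complex structures on normal bundles -/

section Equivariant

variable (E : Type*) [NormedAddCommGroup E] [NormedSpace ℝ E]
  {M : Type*} [TopologicalSpace M] [ChartedSpace E M]
  [MulAction Circle M] [ContMDiffSMul (𝓡 1) 𝓘(ℝ, E) ∞ Circle M]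

/-- The differential `T_x M → T_{g • x} M` of the action of `g`. -/
def tangentAction (g : Circle) (x : M) :
    TangentSpace 𝓘(ℝ, E) x →ₗ[ℝ] TangentSpace 𝓘(ℝ, E) (g • x) :=
  (mfderiv 𝓘(ℝ, E) 𝓘(ℝ, E) (fun y : M => g • y) x).toLinearMap

/-- The differential of the action preserves the tangent spaces of an invariant set. -/
theorem tangentAction_mem (A : SubMulAction Circle M) (g : Circle) (x : M) :
    ∀ v ∈ tangentTo E (A : Set M) x, tangentAction E g x v ∈ tangentTo E (A : Set M) (g • x) := by
  intro v hv
  have hg : ContMDiff 𝓘(ℝ, E) 𝓘(ℝ, E) ∞ (fun y : M => g • y) :=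
    ContMDiffSMul.contMDiff_const_smul (I := 𝓡 1) g
  induction hv using Submodule.span_induction with
  | mem v hv =>
    obtain ⟨γ, rfl, hγ, rfl⟩ := hv
    refine Submodule.subset_span ⟨fun t => g • γ t, rfl, ?_, ?_⟩
    · filter_upwards [hγ] with t ht
      exact ⟨A.smul_mem g ht.1, hg.contMDiffAt.comp t ht.2⟩
    · have h0 : MDifferentiableAt 𝓘(ℝ, ℝ) 𝓘(ℝ, E) γ 0 :=
        hγ.self_of_nhds.2.mdifferentiableAt (by simp)
      have h1 : MDifferentiableAt 𝓘(ℝ, E) 𝓘(ℝ, E) (fun y : M => g • y) (γ 0) :=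
        hg.contMDiffAt.mdifferentiableAt (by simp)
      have := mfderiv_comp (0 : ℝ) h1 h0
      exact congrArg (fun L : ℝ →L[ℝ] E => L 1) this
  | zero => simp
  | add v w _ _ hv hw => rw [map_add]; exact add_mem hv hw
  | smul c v _ hv => rw [map_smul]; exact Submodule.smul_mem _ c hv

/-- The action on the tangent spaces of an invariant set. -/
def tangentToAction (A : SubMulAction Circle M) (g : Circle) (x : M) :
    tangentTo E (A : Set M) x →ₗ[ℝ] tangentTo E (A : Set M) (g • x) :=
  (tangentAction E g x).restrict (tangentAction_mem E A g x)

/-- The action `N_x → N_{g • x}` on the normal bundle of `X` in `A` induced by the differential. -/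
def normalAction (A X : SubMulAction Circle M) (g : Circle) (x : M) :
    NormalSpace E (A : Set M) (X : Set M) x →ₗ[ℝ]
      NormalSpace E (A : Set M) (X : Set M) (g • x) :=
  Submodule.mapQ _ _ (tangentToAction E A g x)
    fun v hv => tangentAction_mem E X g x (v : TangentSpace 𝓘(ℝ, E) x) hv

variable [IsManifold 𝓘(ℝ, E) ∞ M]

/-- An equivariant fiberwise complex structure on the normal bundle of `X` in `A`: a smooth field
`J` of endomorphisms of the fibres over `X` with `J ^ 2 = -1` that commutes with the circle action
on the bundle. Smoothness means that `J` maps smooth local sections to smooth local sections.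
The values of `J` outside `X` are irrelevant. -/
structure EquivariantComplexStructure (A X : SubMulAction Circle M) where
  /-- The endomorphisms of the fibres. -/
  J : ∀ x : M, Module.End ℝ (NormalSpace E (A : Set M) (X : Set M) x)
  sq_eq : ∀ x ∈ X, ∀ n, J x (J x n) = -n
  smooth : ∀ O : Set M, IsOpen O →
    ∀ s : ∀ x : M, NormalSpace E (A : Set M) (X : Set M) x,
      IsSmoothNormalSectionOn E (A : Set M) (X : Set M) O s →
        IsSmoothNormalSectionOn E (A : Set M) (X : Set M) O fun x => J x (s x)
  equivariant : ∀ g : Circle, ∀ x ∈ X, ∀ n,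
    J (g • x) (normalAction E A X g x n) = normalAction E A X g x (J x n)

variable (M) [ContinuousSMul Circle M]

/-- The normal bundle (in `M`) of every orbit type stratum admits an equivariant fiberwise complex
structure. -/
def ConditionBundleComplex : Prop :=
  ∀ x : M, Nonempty (EquivariantComplexStructure E (⊤ : SubMulAction Circle M) (orbitTypeStratum x))

/-- Whenever an orbit type stratum `X` (through `x`) is contained in the closure of another orbit
type stratum `Y` (through `y`) and the index of `Stab Y` in `Stab X` is `2`, the normal bundle of
`X` in the closure of `Y` admits an equivariant fiberwise complex structure. -/
def ConditionRestriction : Prop :=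
  ∀ x y : M, orbitTypeStratum x ≠ orbitTypeStratum y →
    (orbitTypeStratum x : Set M) ⊆ closure (orbitTypeStratum y : Set M) →
    (MulAction.stabilizer Circle y).relIndex (MulAction.stabilizer Circle x) = 2 →
    Nonempty (EquivariantComplexStructure E (invClosure (orbitTypeStratum y)) (orbitTypeStratum x))

end Equivariant

end CircleManifold

end

/-!
Let `X` be the stratum of a point `x`. The idea is to find an element `ζ` of finite order in the
stabilizer of `x` such that, at every point `z` of `X`, the tangent space of `X` is the fixed space
of the isotropy endomorphism `T` of `ζ` on `T_z M`. Then `T` acts on the normal space without the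
eigenvalue `1`. On the part without the eigenvalue `-1`, a fixed real polynomial `P T`, whose value
at each non-real root of unity is `i` or `-i`, is a complex structure; it is smooth and equivariant
because `T` is. On the part where `T = -1`, the projection onto which is again a polynomial `Q T`,
the complex structure comes from the hypothesis: this part is the normal bundle of `X` in the
closure of a stratum `Y` with stabilizer of index two (`nonempty_equivariantComplexStructure_top`
puts the two parts together).

The element `ζ` (`exists_isOfFinOrder_forall_mem_tangentTo_iff`). If the stabilizer is finite, `ζ`
is a generator. If it is the whole circle, `ζ = exp (2 π i / 3 ^ m)` with `m` large: the dimensions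
of the fixed spaces of these elements decrease with `m` and are constant along `X`, and near a
given point the fixed points of `ζ` are fixed by the circle once `m` is large, since there are no
orbits of small positive period (`eventually_stabilizer_eq_top_of_small_period`). As `ζ` has odd
order, `-1` is not an eigenvalue in this case. That the tangent spaces are fixed spaces follows
from a chart in which `ζ` is linear (`exists_linearizing_chart`) and from the semicontinuity of
stabilizers (`eventually_stabilizer_le`).

The stratum `Y` (`exists_stratum_of_index_two`). Suppose that `ζ` generates the stabilizer and that
`-1` is an eigenvalue. The points near `X` that are fixed by `ζ ^ 2` but not by `ζ` have stabilizer
generated by `ζ ^ 2`. Near a given point of `X` they lie in one stratum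
(`eventually_mem_orbitTypeStratum_prod`), which is then the same along all of the connected set
`X`. So the closure of this stratum `Y` is, near `X`, the set of fixed points of `ζ ^ 2`, and its
tangent space is the fixed space of `T ^ 2`.
-/

namespace CircleManifold

/-! ### Polynomials in an endomorphism of finite order -/

open Polynomial in
/-- Interpolation at roots of unity: a function that commutes with complex conjugation agrees on the
roots of unity of order dividing `N` with a real polynomial. -/
theorem exists_aeval_eq_of_conj {N : ℕ} (hN : 0 < N) (f : ℂ → ℂ)
    (hf : ∀ z, f (starRingEnd ℂ z) = starRingEnd ℂ (f z)) :
    ∃ R : ℝ[X], ∀ z : ℂ, z ^ N = 1 → aeval z R = f z := by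
  let s : Finset ℂ := Polynomial.nthRootsFinset N (1 : ℂ)
  have hs : ∀ z : ℂ, z ∈ s ↔ z ^ N = 1 := fun z => Polynomial.mem_nthRootsFinset hN 1
  let p : ℂ[X] := Lagrange.interpolate s id f
  have hp : ∀ z : ℂ, z ^ N = 1 → p.eval z = f z := fun z hz =>
    Lagrange.eval_interpolate_at_node f (Set.injOn_id _) ((hs z).2 hz)
  refine ⟨∑ i ∈ Finset.range (p.natDegree + 1), monomial i (p.coeff i).re, fun z hz => ?_⟩
  have hz' : (starRingEnd ℂ z) ^ N = 1 := by rw [← map_pow, hz, map_one]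
  have h1 := hp z hz
  have h2 := congrArg (starRingEnd ℂ) (hp _ hz')
  rw [hf, Complex.conj_conj] at h2
  rw [eval_eq_sum_range] at h1 h2
  rw [map_sum] at h2
  simp only [map_mul, map_pow, Complex.conj_conj] at h2
  simp only [map_sum, aeval_monomial]
  have h3 : ∀ i ∈ Finset.range (p.natDegree + 1), algebraMap ℝ ℂ (p.coeff i).re * z ^ i =
      (p.coeff i * z ^ i + starRingEnd ℂ (p.coeff i) * z ^ i) / 2 := by
    intro i _
    rw [← add_mul, Complex.add_conj]
    simp
    ring
  rw [Finset.sum_congr rfl h3, ← Finset.sum_div, Finset.sum_add_distrib, h1, h2]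
  ring

open Polynomial in
theorem X_pow_sub_one_dvd_of_forall_aeval_eq_zero {N : ℕ} (hN : 0 < N) {R : ℝ[X]}
    (hR : ∀ z : ℂ, z ^ N = 1 → aeval z R = 0) : X ^ N - 1 ∣ R := by
  rw [← Polynomial.map_dvd_map' (algebraMap ℝ ℂ)]
  simp only [Polynomial.map_sub, Polynomial.map_pow, map_X, Polynomial.map_one]
  rw [X_pow_sub_one_eq_prod hN (Complex.isPrimitiveRoot_exp N hN.ne')]
  refine Finset.prod_dvd_of_coprime ?_ ?_
  · intro a _ b _ hab
    exact isCoprime_X_sub_C_of_isUnit_sub (sub_ne_zero.2 hab).isUnit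
  · intro z hz
    rw [dvd_iff_isRoot, IsRoot, eval_map_algebraMap]
    exact hR z ((Polynomial.mem_nthRootsFinset hN 1).1 hz)

open Polynomial in
/-- If `T ^ n = 1`, then some polynomial `P T` is a complex structure on the sum of the eigenspaces
of `T` (over `ℂ`) for non-real eigenvalues and vanishes on the eigenspaces for `1` and `-1`, and
some polynomial `Q T` is the projection onto the eigenspace for `-1`. The first and the last
property are stated modulo the vectors fixed by `T`. The value of `P` at a root of unity `z` is `i`
times the sign of the imaginary part of `z`. -/
theorem exists_complexStructure_polynomials {n : ℕ} (hn : 0 < n) :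
    ∃ P Q : ℝ[X], ∀ {V : Type*} [AddCommGroup V] [Module ℝ V] (T : Module.End ℝ V), T ^ n = 1 →
      (∀ v, T (aeval T P (aeval T P v) + v - aeval T Q v) =
        aeval T P (aeval T P v) + v - aeval T Q v) ∧
      (∀ v, T (aeval T Q v) = - aeval T Q v) ∧
      (∀ v, aeval T Q (aeval T P v) = 0) ∧
      (∀ v, T (T v) = v → aeval T P v = 0) ∧
      (∀ v, T (T v) = v → T (aeval T Q v - v) = aeval T Q v - v) := by
  -- the exponent `2 * n` makes both `1` and `-1` interpolation nodes, whatever the parity of `n`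
  obtain ⟨P, hP⟩ := exists_aeval_eq_of_conj (N := 2 * n) (by omega)
    (fun z => Complex.I * (SignType.sign z.im : ℝ)) (by
      intro z
      simp [Left.sign_neg])
  obtain ⟨Q, hQ⟩ := exists_aeval_eq_of_conj (N := 2 * n) (by omega)
    (fun z => if z = -1 then 1 else 0) (by
      intro z
      have : starRingEnd ℂ z = -1 ↔ z = -1 := by
        constructor
        · intro h
          rw [← Complex.conj_conj z, h]
          simp
        · rintro rfl
          simp
      simp only [this]
      split_ifs <;> simp)
  have two_imp : ∀ z : ℂ, z ^ 2 = 1 → z ^ (2 * n) = 1 := fun z hz => by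
    rw [pow_mul, hz, one_pow]
  -- the real roots of unity are `1` and `-1`
  have real_root : ∀ z : ℂ, z ^ (2 * n) = 1 → z.im = 0 → z = 1 ∨ z = -1 := by
    intro z hz h0
    obtain ⟨r, rfl⟩ : ∃ r : ℝ, z = r := ⟨z.re, Complex.ext (by simp) (by simpa using h0)⟩
    have hr : r ^ (2 * n) = 1 := by exact_mod_cast hz
    rw [pow_mul] at hr
    have hr2 : r ^ 2 = 1 := (pow_eq_one_iff_of_nonneg (sq_nonneg r) hn.ne').1 hr
    rcases mul_self_eq_one_iff.1 ((pow_two r).symm.trans hr2) with h | h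
    · left; rw [h]; simp
    · right; rw [h]; simp
  have sign_sq : ∀ z : ℂ, z.im ≠ 0 →
      (Complex.I * (SignType.sign z.im : ℝ)) * (Complex.I * (SignType.sign z.im : ℝ)) = -1 := by
    intro z hz
    rcases lt_or_gt_of_ne hz with h | h <;> simp [h]
  obtain ⟨A, hA⟩ : X ^ (2 * n) - 1 ∣ (X - 1) * (P * P + 1 - Q) := by
    refine X_pow_sub_one_dvd_of_forall_aeval_eq_zero (by omega) fun z hz => ?_
    simp only [map_mul, map_sub, map_add, aeval_X, map_one, hP z hz, hQ z hz]
    by_cases h0 : z.im = 0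
    · rcases real_root z hz h0 with rfl | rfl <;> simp
    · have h1 : z ≠ -1 := by rintro rfl; simp at h0
      rw [if_neg h1, sign_sq z h0]; ring
  obtain ⟨B, hB⟩ : X ^ (2 * n) - 1 ∣ (X + 1) * Q := by
    refine X_pow_sub_one_dvd_of_forall_aeval_eq_zero (by omega) fun z hz => ?_
    simp only [map_mul, map_add, aeval_X, map_one, hQ z hz]
    split_ifs with h <;> simp [h]
  obtain ⟨C, hC⟩ : X ^ (2 * n) - 1 ∣ Q * P := by
    refine X_pow_sub_one_dvd_of_forall_aeval_eq_zero (by omega) fun z hz => ?_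
    simp only [map_mul, hP z hz, hQ z hz]
    split_ifs with h <;> simp [h]
  obtain ⟨D, hD⟩ : X ^ 2 - 1 ∣ P := by
    refine X_pow_sub_one_dvd_of_forall_aeval_eq_zero (by omega) fun z hz => ?_
    rw [hP z (two_imp z hz)]
    rcases mul_self_eq_one_iff.1 ((pow_two z).symm.trans hz) with rfl | rfl <;> simp
  obtain ⟨F, hF⟩ : X ^ 2 - 1 ∣ (X - 1) * (Q - 1) := by
    refine X_pow_sub_one_dvd_of_forall_aeval_eq_zero (by omega) fun z hz => ?_
    simp only [map_mul, map_sub, aeval_X, map_one, hQ z (two_imp z hz)]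
    rcases mul_self_eq_one_iff.1 ((pow_two z).symm.trans hz) with rfl | rfl <;> simp
  refine ⟨P, Q, fun {V} _ _ T hT => ?_⟩
  have hT2 : T ^ (2 * n) = 1 := by rw [mul_comm, pow_mul, hT, one_pow]
  have big : ∀ R S : ℝ[X], R = (X ^ (2 * n) - 1) * S → aeval T R = 0 := by
    rintro R S rfl
    simp [hT2]
  have small : ∀ R S : ℝ[X], R = (X ^ 2 - 1) * S → ∀ v, T (T v) = v → aeval T R v = 0 := by
    rintro R S rfl v hv
    have : aeval T (X ^ 2 - 1 : ℝ[X]) v = 0 := by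
      simp [pow_two, hv]
    rw [mul_comm, map_mul, Module.End.mul_apply, this, map_zero]
  refine ⟨fun v => ?_, fun v => ?_, fun v => ?_, small _ _ hD, fun v hv => ?_⟩
  · have := LinearMap.congr_fun (big _ _ hA) v
    simpa [sub_eq_zero] using this
  · have := LinearMap.congr_fun (big _ _ hB) v
    simp only [map_mul, map_add, aeval_X, map_one, Module.End.mul_apply, LinearMap.add_apply,
      Module.End.one_apply, LinearMap.zero_apply] at this
    exact eq_neg_of_add_eq_zero_left this
  · have := LinearMap.congr_fun (big _ _ hC) v
    simpa using this
  · have := small _ _ hF v hv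
    simpa [sub_eq_zero] using this

/-! ### Linearization of an element of finite order near a fixed point -/

/-- The inverse function theorem, with smoothness of the map and of its inverse on open sets. -/
theorem exists_openPartialHomeomorph_of_contDiffOn {E : Type*} [NormedAddCommGroup E]
    [NormedSpace ℝ E] [CompleteSpace E] {f : E → E} {W : Set E} (hW : IsOpen W) {p : E}
    (hp : p ∈ W) (hf : ContDiffOn ℝ ∞ f W)
    (hf' : HasFDerivAt f (ContinuousLinearEquiv.refl ℝ E : E →L[ℝ] E) p) :
    ∃ h : OpenPartialHomeomorph E E, p ∈ h.source ∧ h.source ⊆ W ∧ ⇑h = f ∧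
      ContDiffOn ℝ ∞ h.symm h.target := by
  have hfp : ContDiffAt ℝ ∞ f p := hf.contDiffAt (hW.mem_nhds hp)
  let h₀ := hfp.toOpenPartialHomeomorph f hf' (by simp)
  let W' : Set E := W ∩ fderiv ℝ f ⁻¹' Set.range ((↑) : (E ≃L[ℝ] E) → E →L[ℝ] E)
  have hW' : IsOpen W' :=
    (hf.continuousOn_fderiv_of_isOpen hW (by simp)).isOpen_inter_preimage hW
      ContinuousLinearEquiv.isOpen
  have hpW' : p ∈ W' := ⟨hp, ContinuousLinearEquiv.refl ℝ E, hf'.fderiv.symm⟩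
  refine ⟨h₀.restrOpen W' hW', ⟨hfp.mem_toOpenPartialHomeomorph_source hf' (by simp), hpW'⟩,
    fun x hx => hx.2.1, rfl, fun v hv => ?_⟩
  obtain ⟨hxW, L, hL⟩ := ((h₀.restrOpen W' hW').map_target hv).2
  have hcd : ContDiffAt ℝ ∞ f ((h₀.restrOpen W' hW').symm v) := hf.contDiffAt (hW.mem_nhds hxW)
  refine (OpenPartialHomeomorph.contDiffAt_symm _ (f₀' := L) hv ?_ hcd).contDiffWithinAt
  rw [hL]
  exact (hcd.differentiableAt (by simp)).hasFDerivAt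

theorem contMDiff_smul_left (E : Type*) [NormedAddCommGroup E] [NormedSpace ℝ E]
    {M : Type*} [TopologicalSpace M] [ChartedSpace E M]
    [MulAction Circle M] [ContMDiffSMul (𝓡 1) 𝓘(ℝ, E) ∞ Circle M] (g : Circle) :
    ContMDiff 𝓘(ℝ, E) 𝓘(ℝ, E) ∞ (fun y : M => g • y) :=
  ContMDiffSMul.contMDiff_const_smul (I := 𝓡 1) g

section

variable {E : Type*} [NormedAddCommGroup E] [NormedSpace ℝ E] [FiniteDimensional ℝ E]
  {M : Type*} [TopologicalSpace M]
  [ChartedSpace E M] [IsManifold 𝓘(ℝ, E) ∞ M]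
  [MulAction Circle M] [ContMDiffSMul (𝓡 1) 𝓘(ℝ, E) ∞ Circle M]

/-- Bochner's linearization theorem for the cyclic group generated by `ζ`: the average over the
powers `ζ ^ j` of a chart composed with `ζ ^ j` and corrected by the linear part of `ζ ^ (-j)`
intertwines `ζ` with its linear part, and its derivative at the fixed point is the identity. -/
theorem exists_linearizing_chart {ζ : Circle} {n : ℕ} (hn : 0 < n) (hζ : ζ ^ n = 1) {z : M}
    (hz : ζ • z = z) :
    ∃ (A : E →L[ℝ] E) (e : OpenPartialHomeomorph M E), z ∈ e.source ∧ e z = 0 ∧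
      ContMDiffOn 𝓘(ℝ, E) 𝓘(ℝ, E) ∞ e e.source ∧
      ContMDiffOn 𝓘(ℝ, E) 𝓘(ℝ, E) ∞ e.symm e.target ∧
      ∀ᶠ y in 𝓝 z, e (ζ • y) = A (e y) := by
  have : CompleteSpace E := FiniteDimensional.complete ℝ E
  let φ : OpenPartialHomeomorph M E := chartAt E z
  have hφs : ContMDiffOn 𝓘(ℝ, E) 𝓘(ℝ, E) ∞ φ φ.source := contMDiffOn_chart
  have hφt : ContMDiffOn 𝓘(ℝ, E) 𝓘(ℝ, E) ∞ φ.symm φ.target := contMDiffOn_chart_symm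
  have hzs : z ∈ φ.source := mem_chart_source E z
  have hcont : ∀ g : Circle, Continuous fun y : M => g • y := fun g =>
    (contMDiff_smul_left E g).continuous
  have hpow : ∀ j : ℕ, ζ ^ j • z = z := fun j => by
    induction j with
    | zero => simp
    | succ j ih => rw [pow_succ, mul_smul, hz, ih]
  let p : E := φ z
  have hpt : p ∈ φ.target := φ.map_source hzs
  have hpz : φ.symm p = z := φ.left_inv hzs
  -- the powers of `ζ` in the chart
  let G : ℕ → E → E := fun j u => φ (ζ ^ j • φ.symm u)
  let W : Set M := ⋂ j ∈ Finset.range (n + 2), (fun y : M => ζ ^ j • y) ⁻¹' φ.source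
  have hWo : IsOpen W := isOpen_biInter_finset fun j _ => φ.open_source.preimage (hcont _)
  have hWz : z ∈ W := by
    simp only [W, Set.mem_iInter, Set.mem_preimage, hpow]
    exact fun _ _ => hzs
  have hWj : ∀ y ∈ W, ∀ j < n + 2, ζ ^ j • y ∈ φ.source := fun y hy j hj => by
    simp only [W, Set.mem_iInter, Set.mem_preimage] at hy
    exact hy j (Finset.mem_range.2 hj)
  let W' : Set E := φ.target ∩ φ.symm ⁻¹' W
  have hW'o : IsOpen W' := φ.isOpen_inter_preimage_symm hWo
  have hpW' : p ∈ W' := ⟨hpt, by rw [Set.mem_preimage, hpz]; exact hWz⟩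
  have hGs : ∀ j < n + 2, ContDiffOn ℝ ∞ (G j) W' := by
    intro j hj
    rw [← contMDiffOn_iff_contDiffOn]
    have h1 : ContMDiffOn 𝓘(ℝ, E) 𝓘(ℝ, E) ∞ (fun u => ζ ^ j • φ.symm u) W' :=
      (contMDiff_smul_left E (ζ ^ j)).comp_contMDiffOn (hφt.mono Set.inter_subset_left)
    exact hφs.comp h1 fun u hu => hWj _ hu.2 j hj
  have hGp : ∀ j, G j p = p := fun j => by simp only [G, hpz, hpow]; rfl
  have hGcomp : ∀ j, ∀ u ∈ W', G j (G 1 u) = G (j + 1) u := by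
    intro j u hu
    have := φ.left_inv (hWj _ hu.2 1 (by omega))
    simp only [G]
    rw [this, pow_one, pow_succ, mul_smul]
  let A : E →L[ℝ] E := fderiv ℝ (G 1) p
  have hA : HasFDerivAt (G 1) A p :=
    (((hGs 1 (by omega)).contDiffAt (hW'o.mem_nhds hpW')).differentiableAt (by simp)).hasFDerivAt
  have hGd : ∀ j : ℕ, HasFDerivAt (G j) (A ^ j) p := by
    intro j
    induction j with
    | zero =>
      refine (hasFDerivAt_id p).congr_of_eventuallyEq ?_
      filter_upwards [φ.open_target.mem_nhds hpt] with u hu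
      simp [G, φ.right_inv hu]
    | succ j ih =>
      have h1 : HasFDerivAt (G j) (A ^ j) (G 1 p) := by rw [hGp]; exact ih
      refine (h1.comp p hA).congr_of_eventuallyEq ?_
      filter_upwards [hW'o.mem_nhds hpW'] with u hu
      exact (hGcomp j u hu).symm
  have hAn : A ^ n = 1 := by
    refine (hGd n).unique ((hasFDerivAt_id p).congr_of_eventuallyEq ?_)
    filter_upwards [φ.open_target.mem_nhds hpt] with u hu
    simp [G, hζ, φ.right_inv hu]
  -- the average of the chart over the powers of `ζ`
  let Ψ : E → E := fun u =>
    (n : ℝ)⁻¹ • ∑ j ∈ Finset.range n, (A ^ (n - j)) (G j u - p)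
  have hΨs : ContDiffOn ℝ ∞ Ψ W' := by
    refine ContDiffOn.const_smul _ (ContDiffOn.sum fun j hj => ?_)
    have := Finset.mem_range.1 hj
    exact (A ^ (n - j)).contDiff.comp_contDiffOn ((hGs j (by omega)).sub contDiffOn_const)
  have hn0 : (n : ℝ) ≠ 0 := by exact_mod_cast hn.ne'
  have hΨd : HasFDerivAt Ψ (ContinuousLinearEquiv.refl ℝ E : E →L[ℝ] E) p := by
    have h1 : HasFDerivAt Ψ ((n : ℝ)⁻¹ • ∑ j ∈ Finset.range n, (A ^ (n - j)).comp (A ^ j)) p :=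
      (HasFDerivAt.fun_sum fun j _ =>
        (A ^ (n - j)).hasFDerivAt.comp p ((hGd j).sub_const p)).const_smul _
    convert h1 using 1
    have h2 : ∀ j ∈ Finset.range n, (A ^ (n - j)).comp (A ^ j) = 1 := fun j hj => by
      have := Finset.mem_range.1 hj
      change A ^ (n - j) * A ^ j = 1
      rw [← pow_add, Nat.sub_add_cancel this.le, hAn]
    rw [Finset.sum_congr rfl h2, Finset.sum_const, Finset.card_range, ← Nat.cast_smul_eq_nsmul ℝ,
      smul_smul, inv_mul_cancel₀ hn0, one_smul]
    rfl
  have hΨA : ∀ u ∈ W', Ψ (G 1 u) = A (Ψ u) := by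
    intro u hu
    simp only [Ψ, map_smul, map_sum]
    congr 1
    have h1 : ∀ j ∈ Finset.range n, (A ^ (n - j)) (G j (G 1 u) - p) =
        (A ^ (n + 1 - (j + 1))) (G (j + 1) u - p) := fun j _ => by
      rw [hGcomp j u hu, Nat.add_sub_add_right]
    have h2 : ∀ j ∈ Finset.range n, A ((A ^ (n - j)) (G j u - p)) =
        (A ^ (n + 1 - j)) (G j u - p) := fun j hj => by
      have := Finset.mem_range.1 hj
      rw [Nat.succ_sub this.le, pow_succ']
      rfl
    rw [Finset.sum_congr rfl h1, Finset.sum_congr rfl h2]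
    have h3 := Finset.sum_range_succ' (fun j => (A ^ (n + 1 - j)) (G j u - p)) n
    rw [Finset.sum_range_succ] at h3
    have h4 : (A ^ (n + 1 - n)) (G n u - p) = (A ^ (n + 1 - 0)) (G 0 u - p) := by
      have h5 : G n u = G 0 u := by simp [G, hζ]
      rw [h5, Nat.sub_zero, pow_succ, hAn, one_mul, Nat.add_sub_cancel_left, pow_one]
    rw [h4] at h3
    exact (add_right_cancel h3).symm
  obtain ⟨h, hps, hsW, hh, hhs⟩ :=
    exists_openPartialHomeomorph_of_contDiffOn hW'o hpW' hΨs hΨd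
  refine ⟨A, φ.trans h, ?_, ?_, ?_, ?_, ?_⟩
  · rw [OpenPartialHomeomorph.trans_source]
    exact ⟨hzs, hps⟩
  · simp only [OpenPartialHomeomorph.coe_trans, Function.comp_apply, hh]
    change Ψ p = 0
    simp [Ψ, hGp]
  · rw [OpenPartialHomeomorph.trans_source, OpenPartialHomeomorph.coe_trans, hh]
    exact (contMDiffOn_iff_contDiffOn.2 hΨs).comp (hφs.mono Set.inter_subset_left)
      fun y hy => hsW hy.2
  · rw [OpenPartialHomeomorph.trans_target, OpenPartialHomeomorph.coe_trans_symm]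
    exact hφt.comp ((contMDiffOn_iff_contDiffOn.2 hhs).mono Set.inter_subset_left)
      fun y hy => hy.2
  · filter_upwards [φ.open_source.mem_nhds hzs, hWo.mem_nhds hWz] with y hy hyW
    have h1 := hΨA (φ y) ⟨φ.map_source hy, by rw [Set.mem_preimage, φ.left_inv hy]; exact hyW⟩
    simp only [OpenPartialHomeomorph.coe_trans, Function.comp_apply, hh]
    rw [← h1]
    simp [G, φ.left_inv hy]

end

/-! ### Semicontinuity of stabilizers -/

/-- A periodic curve is constant if its translation increments `c (t + s) - c t` vary with `t` by
at most half of the displacement `c t - c 0`: the increments average to zero over a period. -/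
theorem eq_of_periodic_of_increment_le {E : Type*} [NormedAddCommGroup E] [NormedSpace ℝ E]
    [CompleteSpace E] {c : ℝ → E} (hc : Continuous c) {T : ℝ} (hT : 0 < T)
    (hper : Function.Periodic c T)
    (h : ∀ s ∈ Set.Icc 0 T, ∀ t ∈ Set.Icc 0 T,
      ‖(c (t + s) - c t) - (c s - c 0)‖ ≤ 2⁻¹ * ‖c t - c 0‖) (s : ℝ) : c s = c 0 := by
  obtain ⟨s₀, hs₀, hmax⟩ := isCompact_Icc.exists_isMaxOn (Set.nonempty_Icc.2 hT.le)
    (f := fun s => ‖c s - c 0‖) (by fun_prop)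
  have hmax' : ∀ t ∈ Set.Icc 0 T, ‖c t - c 0‖ ≤ ‖c s₀ - c 0‖ := fun t ht => hmax ht
  have hint : ∫ t in (0 : ℝ)..T, (c (t + s₀) - c t) = 0 := by
    rw [intervalIntegral.integral_sub (Continuous.intervalIntegrable (by fun_prop) _ _)
      (hc.intervalIntegrable _ _), intervalIntegral.integral_comp_add_right, zero_add, add_comm T,
      hper.intervalIntegral_add_eq s₀ 0, zero_add, sub_self]
  have hint2 : ∫ t in (0 : ℝ)..T, ((c (t + s₀) - c t) - (c s₀ - c 0)) = -(T • (c s₀ - c 0)) := by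
    rw [intervalIntegral.integral_sub (Continuous.intervalIntegrable (by fun_prop) _ _)
      (by simp), hint, intervalIntegral.integral_const]
    simp
  have hle : ‖∫ t in (0 : ℝ)..T, ((c (t + s₀) - c t) - (c s₀ - c 0))‖ ≤
      (2⁻¹ * ‖c s₀ - c 0‖) * |T - 0| := by
    refine intervalIntegral.norm_integral_le_of_norm_le_const fun t ht => ?_
    rw [Set.uIoc_of_le hT.le] at ht
    have ht' : t ∈ Set.Icc 0 T := ⟨ht.1.le, ht.2⟩
    exact (h s₀ hs₀ t ht').trans (by gcongr; exact hmax' t ht')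
  rw [hint2, norm_neg, norm_smul, Real.norm_of_nonneg hT.le, sub_zero, abs_of_pos hT] at hle
  have h0 : ‖c s₀ - c 0‖ = 0 := by
    refine le_antisymm ?_ (norm_nonneg _)
    have : T * ‖c s₀ - c 0‖ ≤ 0 := by nlinarith
    exact nonpos_of_mul_nonpos_right this hT
  obtain ⟨t, ht, hst⟩ := hper.exists_mem_Ico₀ hT s
  have := hmax' t ⟨ht.1, ht.2.le⟩
  rw [h0] at this
  rw [hst]
  exact sub_eq_zero.1 (norm_le_zero_iff.1 this)

/-- There are no orbits of small positive period near `z`. In a chart, the increments over a short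
time `s` depend on the point in a Lipschitz way with a small constant, so that the orbits satisfy
the hypothesis of `eq_of_periodic_of_increment_le`. -/
theorem eventually_stabilizer_eq_top_of_small_period (E : Type*) [NormedAddCommGroup E]
    [NormedSpace ℝ E] [FiniteDimensional ℝ E] {M : Type*} [TopologicalSpace M]
    [ChartedSpace E M] [IsManifold 𝓘(ℝ, E) ∞ M] [MulAction Circle M]
    [ContMDiffSMul (𝓡 1) 𝓘(ℝ, E) ∞ Circle M] (z : M) :
    ∃ ε > (0 : ℝ), ∀ᶠ y in 𝓝 z, ∀ T ∈ Set.Ioo 0 ε, Circle.exp T • y = y →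
      MulAction.stabilizer Circle y = ⊤ := by
  have : CompleteSpace E := FiniteDimensional.complete ℝ E
  let φ : OpenPartialHomeomorph M E := chartAt E z
  have hφs : ContMDiffOn 𝓘(ℝ, E) 𝓘(ℝ, E) ∞ φ φ.source := contMDiffOn_chart
  have hφt : ContMDiffOn 𝓘(ℝ, E) 𝓘(ℝ, E) ∞ φ.symm φ.target := contMDiffOn_chart_symm
  have hzs : z ∈ φ.source := mem_chart_source E z
  let p : E := φ z
  have hpt : p ∈ φ.target := φ.map_source hzs
  have hpz : φ.symm p = z := φ.left_inv hzs
  have hflow : ContMDiff (𝓘(ℝ, ℝ).prod 𝓘(ℝ, E)) 𝓘(ℝ, E) ∞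
      (fun q : ℝ × M => Circle.exp q.1 • q.2) :=
    (contMDiff_circleExp.comp contMDiff_fst).smul (I := 𝓡 1) contMDiff_snd
  let G : ℝ × E → E := fun q => φ (Circle.exp q.1 • φ.symm q.2)
  have hG : ContDiffAt ℝ ∞ G (0, p) := by
    have h1 : ContMDiffAt (𝓘(ℝ, ℝ).prod 𝓘(ℝ, E)) (𝓘(ℝ, ℝ).prod 𝓘(ℝ, E)) ∞
        (fun q : ℝ × E => (q.1, φ.symm q.2)) (0, p) :=
      contMDiffAt_fst.prodMk (ContMDiffAt.comp (0, p)
        (hφt.contMDiffAt (φ.open_target.mem_nhds hpt)) contMDiffAt_snd)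
    have h2 := hflow.contMDiffAt.comp (0, p) h1
    have h3 : ContMDiffAt 𝓘(ℝ, E) 𝓘(ℝ, E) ∞ φ (Circle.exp 0 • φ.symm p) := by
      refine hφs.contMDiffAt (φ.open_source.mem_nhds ?_)
      simpa [hpz] using hzs
    have h4 : ContMDiffAt (𝓘(ℝ, ℝ).prod 𝓘(ℝ, E)) 𝓘(ℝ, E) ∞ G (0, p) :=
      ContMDiffAt.comp (0, p) h3 h2
    rw [← contMDiffAt_iff_contDiffAt, modelWithCornersSelf_prod, ← chartedSpaceSelf_prod]
    exact h4
  have hG' := hG.hasStrictFDerivAt (by simp)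
  set G' : ℝ × E →L[ℝ] E := fderiv ℝ G (0, p)
  have hG'w : ∀ w : E, G' (0, w) = w := by
    have h1 : HasFDerivAt (fun u : E => G (0, u)) (G'.comp (ContinuousLinearMap.inr ℝ ℝ E)) p :=
      hG'.hasFDerivAt.comp p (hasFDerivAt_prodMk_right 0 p)
    have h2 : HasFDerivAt (fun u : E => G (0, u)) (ContinuousLinearMap.id ℝ E) p := by
      refine (hasFDerivAt_id p).congr_of_eventuallyEq ?_
      filter_upwards [φ.open_target.mem_nhds hpt] with u hu
      simp [G, φ.right_inv hu]
    intro w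
    simpa using DFunLike.congr_fun (h1.unique h2) w
  obtain ⟨S, hS, hSa⟩ := hG'.approximates_deriv_on_nhds (c := 2⁻¹) (Or.inr (by positivity))
  have hS' : S ∈ 𝓝 (0 : ℝ) ×ˢ 𝓝 p := by rw [← nhds_prod_eq]; exact hS
  obtain ⟨I, hI, B, hB, hIB⟩ := Filter.mem_prod_iff.1 hS'
  have hN : φ.source ∩ φ ⁻¹' B ∈ 𝓝 (Circle.exp 0 • z) := by
    rw [Circle.exp_zero, one_smul]
    exact Filter.inter_mem (φ.open_source.mem_nhds hzs) (φ.continuousAt hzs hB)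
  have hev : ∀ᶠ q : ℝ × M in 𝓝 0 ×ˢ 𝓝 z, Circle.exp q.1 • q.2 ∈ φ.source ∩ φ ⁻¹' B := by
    rw [← nhds_prod_eq]
    exact hflow.continuous.continuousAt hN
  obtain ⟨pa, hpa, pb, hpb, hab⟩ := Filter.eventually_prod_iff.1 hev
  obtain ⟨ε, hε, hεI⟩ := Metric.eventually_nhds_iff.1 (hpa.and hI)
  refine ⟨ε, hε, ?_⟩
  filter_upwards [hpb] with y hy T hT hTy
  have hsmall : ∀ t ∈ Set.Icc 0 T, dist t 0 < ε := fun t ht => by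
    rw [Real.dist_0_eq_abs, abs_of_nonneg ht.1]
    exact ht.2.trans_lt hT.2
  have hcirc : Function.Periodic (fun t => Circle.exp t • y) T := fun t => by
    simp only [Circle.exp_add, mul_smul, hTy]
  have hmem : ∀ t : ℝ, Circle.exp t • y ∈ φ.source ∩ φ ⁻¹' B := fun t => by
    obtain ⟨t', ht', h⟩ := hcirc.exists_mem_Ico₀ hT.1 t
    rw [h]
    exact hab (hεI (hsmall t' ⟨ht'.1, ht'.2.le⟩)).1 hy
  have hcont : Continuous fun t : ℝ => Circle.exp t • y :=
    hflow.continuous.comp (by fun_prop : Continuous fun t : ℝ => (t, y))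
  let c : ℝ → E := fun t => φ (Circle.exp t • y)
  have hc : Continuous c := φ.continuousOn.comp_continuous hcont fun t => (hmem t).1
  have hcG : ∀ t s, G (s, c t) = c (t + s) := fun t s => by
    simp only [G, c]
    rw [φ.left_inv (hmem t).1, ← mul_smul, ← Circle.exp_add, add_comm]
  have key := eq_of_periodic_of_increment_le hc hT.1
    (fun t => congrArg φ (hcirc t)) (fun s hs t ht => by
      have hsI := (hεI (hsmall s hs)).2
      have := hSa (s, c t) (hIB (Set.mk_mem_prod hsI (hmem t).2))
        (s, c 0) (hIB (Set.mk_mem_prod hsI (hmem 0).2))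
      rw [Prod.mk_sub_mk, sub_self, hG'w, hcG, hcG, zero_add, Prod.norm_mk, norm_zero,
        max_eq_right (norm_nonneg _)] at this
      convert this using 2
      · abel
      · simp)
  refine Subgroup.ext fun g => ⟨fun _ => Subgroup.mem_top _, fun _ => ?_⟩
  rw [MulAction.mem_stabilizer_iff]
  have h1 := φ.injOn (hmem (Complex.arg g)).1 (hmem 0).1 (key _)
  rwa [Circle.exp_arg, Circle.exp_zero, one_smul] at h1

/-- Finite stabilizers are upper semicontinuous. An element `h` near `g ∈ Stab z` that fixes a
point `y` near `z` satisfies `h ^ n = (g⁻¹ * h) ^ n`, and this is a small rotation that fixes `y`.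
-/
theorem eventually_stabilizer_le (E : Type*) [NormedAddCommGroup E]
    [NormedSpace ℝ E] [FiniteDimensional ℝ E] {M : Type*} [TopologicalSpace M]
    [ChartedSpace E M] [IsManifold 𝓘(ℝ, E) ∞ M] [MulAction Circle M]
    [ContMDiffSMul (𝓡 1) 𝓘(ℝ, E) ∞ Circle M] [T2Space M] {z : M} {n : ℕ} (hn : 0 < n)
    (hz : ∀ g ∈ MulAction.stabilizer Circle z, g ^ n = 1) :
    ∀ᶠ y in 𝓝 z, MulAction.stabilizer Circle y ≤ MulAction.stabilizer Circle z := by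
  have hcs : ContinuousSMul Circle M :=
    ContMDiffSMul.continuousSMul (I := 𝓡 1) (I' := 𝓘(ℝ, E)) ∞
  obtain ⟨ε, hε, hev⟩ := eventually_stabilizer_eq_top_of_small_period E z
  have hn' : (0 : ℝ) < n := by exact_mod_cast hn
  obtain ⟨g₀, hg₀⟩ : ∃ g₀ : Circle, g₀ • z ≠ z := by
    by_contra! h
    have h1 := hz (Circle.exp (Real.pi / n)) (h _)
    rw [← Circle.exp_natCast_mul, mul_div_cancel₀ _ hn'.ne'] at h1
    exact Circle.exp_pi_ne_one h1
  have hne : ∀ᶠ y in 𝓝 z, g₀ • y ≠ y :=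
    (isOpen_ne_fun (continuous_const_smul g₀) continuous_id).mem_nhds hg₀
  have main : ∀ g : Circle, ∀ᶠ q : M × Circle in 𝓝 z ×ˢ 𝓝 g,
      q.2 • q.1 = q.1 → q.2 ∈ MulAction.stabilizer Circle z := by
    intro g
    by_cases hg : g • z = z
    · have harg : ∀ᶠ h in 𝓝 g, |Complex.arg (g⁻¹ * h : Circle)| < ε / n := by
        have h1 : ContinuousAt (fun h : Circle => |Complex.arg (g⁻¹ * h : Circle)|) g := by
          refine ContinuousAt.abs ?_
          refine ContinuousAt.comp (g := Complex.arg) ?_ (by fun_prop)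
          refine Complex.continuousAt_arg ?_
          simp
        refine h1.eventually_lt_const ?_
        simpa using div_pos hε hn'
      filter_upwards [(hev.and hne).prod_mk harg] with ⟨y, h⟩ ⟨⟨hy, hy0⟩, hh⟩ hhy
      simp only at hy hy0 hh hhy ⊢
      set w : Circle := g⁻¹ * h with hw
      have hgw : h = g * w := by simp [hw]
      have hwn : w ^ n • y = y := by
        have h1 : w ^ n = h ^ n := by rw [hw, mul_pow, inv_pow, hz g hg, inv_one, one_mul]
        rw [h1]
        exact (MulAction.stabilizer Circle y).pow_mem hhy n
      have hnot : ∀ T ∈ Set.Ioo 0 ε, Circle.exp T • y ≠ y := fun T hT hTy => by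
        have := hy T hT hTy
        have h2 : g₀ ∈ MulAction.stabilizer Circle y := by rw [this]; trivial
        exact hy0 h2
      have hwt : w ^ n = Circle.exp (n * Complex.arg w) := by
        rw [Circle.exp_natCast_mul, Circle.exp_arg]
      rw [abs_lt, lt_div_iff₀ hn', ← neg_div, div_lt_iff₀ hn'] at hh
      rcases lt_trichotomy (Complex.arg w) 0 with hlt | h0 | hgt
      · exfalso
        refine hnot (-(n * Complex.arg w)) ⟨by nlinarith, by linarith⟩ ?_
        rw [Circle.exp_neg, ← hwt, inv_smul_eq_iff, hwn]
      · have : w = 1 := by rw [← Circle.exp_arg w, h0, Circle.exp_zero]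
        rw [hgw, this, mul_one]
        exact hg
      · exfalso
        refine hnot (n * Complex.arg w) ⟨by positivity, by linarith⟩ ?_
        rw [← hwt, hwn]
    · have h1 : ∀ᶠ q : M × Circle in 𝓝 (z, g), q.2 • q.1 ≠ q.1 :=
        (isOpen_ne_fun (f := fun q : M × Circle => q.2 • q.1) (by fun_prop)
        continuous_fst).mem_nhds hg
      rw [nhds_prod_eq] at h1
      filter_upwards [h1] with q hq hq'
      exact absurd hq' hq
  have := isCompact_univ.eventually_forall_of_forall_eventually (K := (Set.univ : Set Circle))
    (x₀ := z) (P := fun y g => g • y = y → g ∈ MulAction.stabilizer Circle z)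
    (fun g _ => by rw [nhds_prod_eq]; exact main g)
  filter_upwards [this] with y hy g hg
  exact hy g trivial hg

/-- A proper closed subgroup of the circle is generated by an element of finite order. -/
theorem eq_zpowers_of_isClosed {H : Subgroup Circle} (hH : IsClosed (H : Set Circle))
    (hne : H ≠ ⊤) : ∃ ζ : Circle, IsOfFinOrder ζ ∧ H = Subgroup.zpowers ζ := by
  have : Fact (0 < 2 * Real.pi) := ⟨Real.two_pi_pos⟩
  let s : AddSubgroup (AddCircle (2 * Real.pi)) :=
    { carrier := {a | AddCircle.toCircle a ∈ H}
      add_mem' := fun {a b} ha hb => by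
        simp only [Set.mem_ofPred_eq, AddCircle.toCircle_add]; exact H.mul_mem ha hb
      zero_mem' := by simp [AddCircle.toCircle_zero]
      neg_mem' := fun {a} ha => by
        simp only [Set.mem_ofPred_eq, AddCircle.toCircle_neg]; exact H.inv_mem ha }
  have hsurj : ∀ g : Circle, ∃ a : AddCircle (2 * Real.pi), AddCircle.toCircle a = g := fun g =>
    ⟨((Complex.arg g : ℝ) : AddCircle (2 * Real.pi)), by
      rw [AddCircle.toCircle_apply_mk, div_self Real.two_pi_pos.ne', one_mul, Circle.exp_arg]⟩
  have hsc : IsClosed (s : Set (AddCircle (2 * Real.pi))) :=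
    hH.preimage AddCircle.continuous_toCircle
  have hnd : ¬ Dense (s : Set (AddCircle (2 * Real.pi))) := fun hd => by
    refine hne (Subgroup.ext fun g => ⟨fun _ => trivial, fun _ => ?_⟩)
    obtain ⟨a, rfl⟩ := hsurj g
    have : a ∈ closure (s : Set (AddCircle (2 * Real.pi))) := hd a
    rwa [hsc.closure_eq] at this
  rw [AddCircle.dense_addSubgroup_iff_ne_zmultiples] at hnd
  push Not at hnd
  obtain ⟨a, ha, hs⟩ := hnd
  have hz : ∀ (k : ℤ) (b : AddCircle (2 * Real.pi)),
      AddCircle.toCircle (k • b) = AddCircle.toCircle b ^ k := fun k b =>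
    AddCircle.toCircle_zsmul b k
  refine ⟨AddCircle.toCircle a, ?_, Subgroup.ext fun g => ?_⟩
  · rw [isOfFinOrder_iff_pow_eq_one]
    refine ⟨addOrderOf a, Nat.pos_of_ne_zero ha, ?_⟩
    have := hz (addOrderOf a) a
    rw [zpow_natCast, natCast_zsmul, addOrderOf_nsmul_eq_zero, AddCircle.toCircle_zero] at this
    exact this.symm
  · obtain ⟨b, rfl⟩ := hsurj g
    have h1 : AddCircle.toCircle b ∈ H ↔ b ∈ s := Iff.rfl
    rw [h1, hs, AddSubgroup.mem_zmultiples_iff, Subgroup.mem_zpowers_iff]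
    refine exists_congr fun k => ?_
    rw [← hz]
    exact (AddCircle.injective_toCircle Real.two_pi_pos.ne').eq_iff.symm

/-! ### Isotropy endomorphisms and linearizing charts -/

/-- A function that is locally constant along a preconnected set is constant on it. -/
theorem eq_of_isPreconnected_of_eventually {X α : Type*} [TopologicalSpace X] {S : Set X}
    (hS : IsPreconnected S) {f : X → α} (hf : ∀ z ∈ S, ∀ᶠ y in 𝓝 z, y ∈ S → f y = f z)
    {x y : X} (hx : x ∈ S) (hy : y ∈ S) : f x = f y := by
  let _ : TopologicalSpace α := ⊥
  have : DiscreteTopology α := ⟨rfl⟩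
  refine hS.constant (f := f) (fun z hz => ?_) hx hy
  refine tendsto_const_nhds.congr' ?_
  rw [Filter.EventuallyEq, eventually_nhdsWithin_iff]
  filter_upwards [hf z hz] with y hy hyS
  exact (hy hyS).symm

section

variable {E : Type*} [NormedAddCommGroup E] [NormedSpace ℝ E]
  {M : Type*} [TopologicalSpace M] [ChartedSpace E M] [MulAction Circle M]

/-- The smooth chart `e` is centred at `z` and turns the action of `g` near `z` into the linear
map `A`. -/
structure IsLinearizingChart (g : Circle) (z : M) (A : E →L[ℝ] E) (e : OpenPartialHomeomorph M E) :
    Prop where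
  mem_source : z ∈ e.source
  map_eq_zero : e z = 0
  contMDiffOn : ContMDiffOn 𝓘(ℝ, E) 𝓘(ℝ, E) ∞ e e.source
  contMDiffOn_symm : ContMDiffOn 𝓘(ℝ, E) 𝓘(ℝ, E) ∞ e.symm e.target
  eventually_map_smul : ∀ᶠ y in 𝓝 z, e (g • y) = A (e y)

namespace IsLinearizingChart

variable {g : Circle} {z : M} {A : E →L[ℝ] E} {e : OpenPartialHomeomorph M E}

theorem zero_mem_target (he : IsLinearizingChart g z A e) : (0 : E) ∈ e.target := by
  rw [← he.map_eq_zero]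
  exact e.map_source he.mem_source

theorem symm_zero (he : IsLinearizingChart g z A e) : e.symm 0 = z := by
  rw [← he.map_eq_zero]
  exact e.left_inv he.mem_source

theorem tendsto_symm (he : IsLinearizingChart g z A e) :
    Filter.Tendsto e.symm (𝓝 0) (𝓝 z) := by
  have := e.continuousAt_symm he.zero_mem_target
  rwa [ContinuousAt, he.symm_zero] at this

theorem exists_ball (he : IsLinearizingChart g z A e) {P : M → Prop} (hP : ∀ᶠ y in 𝓝 z, P y) :
    ∃ r > 0, (∀ u ∈ Metric.ball (0 : E) r, u ∈ e.target ∧ P (e.symm u)) ∧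
      ∀ᶠ y in 𝓝 z, y ∈ e.source ∧ e y ∈ Metric.ball (0 : E) r := by
  have h1 : ∀ᶠ u in 𝓝 (0 : E), u ∈ e.target ∧ P (e.symm u) :=
    (e.open_target.eventually_mem he.zero_mem_target).and (he.tendsto_symm.eventually hP)
  obtain ⟨r, hr, h⟩ := Metric.eventually_nhds_iff_ball.1 h1
  refine ⟨r, hr, h, (e.open_source.eventually_mem he.mem_source).and ?_⟩
  have h2 := e.continuousAt he.mem_source
  rw [ContinuousAt, he.map_eq_zero] at h2
  exact h2.eventually (Metric.ball_mem_nhds 0 hr)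

theorem mdifferentiable (he : IsLinearizingChart g z A e) :
    e.MDifferentiable 𝓘(ℝ, E) 𝓘(ℝ, E) :=
  ⟨he.contMDiffOn.mdifferentiableOn (by simp), he.contMDiffOn_symm.mdifferentiableOn (by simp)⟩

/-- A straight line through the origin of the chart is a smooth curve through `z`, and it can be
given any velocity. -/
theorem line (he : IsLinearizingChart g z A e) {L : E ≃ₗ[ℝ] E}
    (hL : ∀ v, L v = (mfderiv 𝓘(ℝ, E) 𝓘(ℝ, E) e z : E →L[ℝ] E) v) (v : E) :
    (∀ᶠ t in 𝓝 (0 : ℝ), ContMDiffAt 𝓘(ℝ, ℝ) 𝓘(ℝ, E) ∞ (fun t : ℝ => e.symm (t • L v)) t) ∧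
      (mfderiv 𝓘(ℝ, ℝ) 𝓘(ℝ, E) (fun t : ℝ => e.symm (t • L v)) 0 (1 : ℝ) : E) = v := by
  have hlin : ContDiff ℝ ∞ fun t : ℝ => t • L v := by fun_prop
  have h0 : (fun t : ℝ => t • L v) 0 = 0 := by simp
  constructor
  · have h1 : ∀ᶠ t in 𝓝 (0 : ℝ), t • L v ∈ e.target := by
      refine hlin.continuous.continuousAt.eventually ?_
      rw [h0]
      exact e.open_target.eventually_mem he.zero_mem_target
    filter_upwards [h1] with t ht
    exact (he.contMDiffOn_symm.contMDiffAt (e.open_target.mem_nhds ht)).comp t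
      hlin.contMDiff.contMDiffAt
  · have hd : MDifferentiableAt 𝓘(ℝ, E) 𝓘(ℝ, E) e.symm ((fun t : ℝ => t • L v) 0) := by
      rw [h0]
      exact he.mdifferentiable.mdifferentiableAt_symm he.zero_mem_target
    have h1 := mfderiv_comp (0 : ℝ) hd
      (hlin.contMDiff.contMDiffAt.mdifferentiableAt (by simp))
    have h2 := he.mdifferentiable.symm_comp_deriv he.mem_source
    have h3 := congrArg (fun L : ℝ →L[ℝ] E => L 1) h1
    have h4 := congrArg (fun L : E →L[ℝ] E => L v) h2
    have h5 : (mfderiv 𝓘(ℝ, ℝ) 𝓘(ℝ, E) (fun t : ℝ => t • L v) 0 : ℝ →L[ℝ] E) 1 = L v := by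
      rw [mfderiv_eq_fderiv]
      have := ((hasDerivAt_id (0 : ℝ)).smul_const (L v)).hasFDerivAt.fderiv
      simp only [id] at this
      rw [this]
      simp only [one_smul]
      exact one_smul ℝ (L v)
    refine h3.trans (Eq.trans ?_ h4)
    change (mfderiv 𝓘(ℝ, E) 𝓘(ℝ, E) e.symm ((0 : ℝ) • L v) : E →L[ℝ] E)
      ((mfderiv 𝓘(ℝ, ℝ) 𝓘(ℝ, E) (fun t : ℝ => t • L v) 0 : ℝ →L[ℝ] E) 1) =
      (mfderiv 𝓘(ℝ, E) 𝓘(ℝ, E) e.symm (e z) : E →L[ℝ] E)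
        ((mfderiv 𝓘(ℝ, E) 𝓘(ℝ, E) e z : E →L[ℝ] E) v)
    rw [h5, zero_smul, he.map_eq_zero, hL]
    rfl

end IsLinearizingChart

variable [ContMDiffSMul (𝓡 1) 𝓘(ℝ, E) ∞ Circle M]

/-- The differential at `y` of the action of `g`, as an endomorphism of the model space `E` of the
tangent spaces. It is meaningful when `g` fixes `y`: it is then the isotropy representation. -/
noncomputable def isotropyEnd (E : Type*) [NormedAddCommGroup E] [NormedSpace ℝ E]
    {M : Type*} [TopologicalSpace M] [ChartedSpace E M] [MulAction Circle M]
    [ContMDiffSMul (𝓡 1) 𝓘(ℝ, E) ∞ Circle M] (g : Circle) (y : M) : Module.End ℝ E :=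
  tangentAction E g y

theorem mdifferentiableAt_smul (E : Type*) [NormedAddCommGroup E] [NormedSpace ℝ E]
    {M : Type*} [TopologicalSpace M] [ChartedSpace E M] [MulAction Circle M]
    [ContMDiffSMul (𝓡 1) 𝓘(ℝ, E) ∞ Circle M] (g : Circle) (y : M) :
    MDifferentiableAt 𝓘(ℝ, E) 𝓘(ℝ, E) (fun y : M => g • y) y :=
  (contMDiff_smul_left E g).contMDiffAt.mdifferentiableAt (by simp)

theorem isotropyEnd_mul_apply (g h : Circle) (y : M) (v : E) :
    isotropyEnd E (g * h) y v = isotropyEnd E g (h • y) (isotropyEnd E h y v) := by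
  have h1 := mfderiv_comp y (mdifferentiableAt_smul E g (h • y)) (mdifferentiableAt_smul E h y)
  have h2 : ((fun y : M => g • y) ∘ fun y : M => h • y) = fun y : M => (g * h) • y := by
    funext y
    simp [mul_smul]
  rw [h2] at h1
  exact congrArg (fun L : E →L[ℝ] E => L v) h1

theorem isotropyEnd_mul {h : Circle} {y : M} (hy : h • y = y) (g : Circle) :
    isotropyEnd E (g * h) y = isotropyEnd E g y * isotropyEnd E h y := by
  ext v
  rw [isotropyEnd_mul_apply, hy]
  rfl

theorem isotropyEnd_one (y : M) : isotropyEnd E 1 y = 1 := by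
  have h2 : (fun y : M => (1 : Circle) • y) = id := by
    funext y
    simp
  have h1 : mfderiv 𝓘(ℝ, E) 𝓘(ℝ, E) (fun y : M => (1 : Circle) • y) y =
      mfderiv 𝓘(ℝ, E) 𝓘(ℝ, E) (id : M → M) y := by rw [h2]
  ext v
  have h3 : isotropyEnd E 1 y v = (mfderiv 𝓘(ℝ, E) 𝓘(ℝ, E) (id : M → M) y : E →L[ℝ] E) v :=
    congrArg (fun L : E →L[ℝ] E => L v) h1
  rw [h3, mfderiv_id]
  rfl

theorem isotropyEnd_pow {g : Circle} {y : M} (hy : g • y = y) (k : ℕ) :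
    isotropyEnd E (g ^ k) y = isotropyEnd E g y ^ k := by
  induction k with
  | zero => rw [pow_zero, pow_zero, isotropyEnd_one]
  | succ k ih => rw [pow_succ, isotropyEnd_mul hy, ih, pow_succ]

/-- Tangent vectors to a set of fixed points are fixed. -/
theorem isotropyEnd_eq_of_mem_tangentTo {g : Circle} {A : Set M} (hA : ∀ y ∈ A, g • y = y) {z : M}
    {v : E} (hv : v ∈ tangentTo E A z) : isotropyEnd E g z v = v := by
  induction hv using Submodule.span_induction with
  | mem v hv =>
    obtain ⟨γ, rfl, hγ, rfl⟩ := hv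
    have h0 : MDifferentiableAt 𝓘(ℝ, ℝ) 𝓘(ℝ, E) γ 0 :=
      hγ.self_of_nhds.2.mdifferentiableAt (by simp)
    have h1 := mfderiv_comp (0 : ℝ) (mdifferentiableAt_smul E g (γ 0)) h0
    have h2 : ((fun y : M => g • y) ∘ γ) =ᶠ[𝓝 0] γ := by
      filter_upwards [hγ] with t ht
      exact hA _ ht.1
    have h3 := h2.mfderiv_eq (I := 𝓘(ℝ, ℝ)) (I' := 𝓘(ℝ, E))
    have h4 := congrArg (fun L : ℝ →L[ℝ] E => L 1) h1
    have h5 := congrArg (fun L : ℝ →L[ℝ] E => L 1) h3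
    exact h4.symm.trans h5
  | zero => exact map_zero _
  | add v w _ _ hv hw => exact (map_add _ _ _).trans (congrArg₂ (· + ·) hv hw)
  | smul c v _ hv => exact (map_smul _ _ _).trans (congrArg (c • ·) hv)

namespace IsLinearizingChart

variable {g : Circle} {z : M} {A : E →L[ℝ] E} {e : OpenPartialHomeomorph M E}

theorem eventually_smul_eq_iff (he : IsLinearizingChart g z A e) (hz : g • z = z) :
    ∀ᶠ y in 𝓝 z, g • y = y ↔ A (e y) = e y := by
  have hg : Filter.Tendsto (fun y : M => g • y) (𝓝 z) (𝓝 z) := by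
    have := (contMDiff_smul_left E (M := M) g).continuous.tendsto z
    rwa [hz] at this
  filter_upwards [he.eventually_map_smul, e.open_source.eventually_mem he.mem_source,
    hg.eventually (e.open_source.eventually_mem he.mem_source)] with y h1 h2 h3
  rw [← h1]
  exact ⟨fun h => by rw [h], fun h => e.injOn h3 h2 h⟩

/-- Near `z`, the differential of the chart conjugates the isotropy endomorphism at a fixed point
to `A`. -/
theorem eventually_conj (he : IsLinearizingChart g z A e) :
    ∀ᶠ y in 𝓝 z, g • y = y →
      ∃ L : E ≃ₗ[ℝ] E, (∀ v, L v = (mfderiv 𝓘(ℝ, E) 𝓘(ℝ, E) e y : E →L[ℝ] E) v) ∧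
        ∀ v, L (isotropyEnd E g y v) = A (L v) := by
  filter_upwards [he.eventually_map_smul.eventually_nhds,
    e.open_source.eventually_mem he.mem_source] with y hy hys hgy
  have hd := he.mdifferentiable.mdifferentiableAt hys
  have hd' : MDifferentiableAt 𝓘(ℝ, E) 𝓘(ℝ, E) e (g • y) := by rwa [hgy]
  let L₀ : E →L[ℝ] E := mfderiv 𝓘(ℝ, E) 𝓘(ℝ, E) e y
  have hL : Function.Bijective (L₀ : E →ₗ[ℝ] E) := he.mdifferentiable.mfderiv_bijective hys
  refine ⟨LinearEquiv.ofBijective (L₀ : E →ₗ[ℝ] E) hL, fun v => rfl, fun v => ?_⟩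
  have h1 := mfderiv_comp y hd' (mdifferentiableAt_smul E g y)
  have hA : MDifferentiableAt 𝓘(ℝ, E) 𝓘(ℝ, E) A (e y) :=
    A.differentiableAt.mdifferentiableAt
  have h2 := mfderiv_comp y hA hd
  have h3 : (e ∘ fun y : M => g • y) =ᶠ[𝓝 y] A ∘ e := hy
  have h4 := h3.mfderiv_eq (I := 𝓘(ℝ, E)) (I' := 𝓘(ℝ, E))
  have h5 : (mfderiv 𝓘(ℝ, E) 𝓘(ℝ, E) A (e y) : E →L[ℝ] E) = A := by
    rw [mfderiv_eq_fderiv]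
    exact A.fderiv
  have h6 : (mfderiv 𝓘(ℝ, E) 𝓘(ℝ, E) e (g • y) : E →L[ℝ] E) = L₀ := by rw [hgy]
  have h7 : (mfderiv 𝓘(ℝ, E) 𝓘(ℝ, E) e (g • y) : E →L[ℝ] E) (isotropyEnd E g y v) =
      (mfderiv 𝓘(ℝ, E) 𝓘(ℝ, E) A (e y) : E →L[ℝ] E) (L₀ v) := by
    have a1 := congrArg (fun L : E →L[ℝ] E => L v) h1
    have a2 := congrArg (fun L : E →L[ℝ] E => L v) h2
    have a4 := congrArg (fun L : E →L[ℝ] E => L v) h4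
    exact a1.symm.trans (a4.trans a2)
  rw [h5, h6] at h7
  exact h7

end IsLinearizingChart

end

/-! ### Tangent spaces of fixed point sets and of strata -/

section

variable {M : Type*} [TopologicalSpace M] [MulAction Circle M] [ContinuousSMul Circle M]

theorem mem_orbitTypeStratum_self (x : M) : x ∈ orbitTypeStratum x :=
  mem_connectedComponentIn rfl

theorem stabilizer_eq_of_mem_orbitTypeStratum {x y : M} (hy : y ∈ orbitTypeStratum x) :
    MulAction.stabilizer Circle y = MulAction.stabilizer Circle x :=
  connectedComponentIn_subset
    {y : M | MulAction.stabilizer Circle y = MulAction.stabilizer Circle x} x hy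

theorem isPreconnected_orbitTypeStratum (x : M) :
    IsPreconnected (orbitTypeStratum x : Set M) :=
  isPreconnected_connectedComponentIn

theorem mem_orbitTypeStratum_of_isPreconnected {x z y : M} {S : Set M} (hS : IsPreconnected S)
    (hst : ∀ w ∈ S, MulAction.stabilizer Circle w = MulAction.stabilizer Circle x) (hz : z ∈ S)
    (hy : y ∈ S) (hzx : z ∈ orbitTypeStratum x) : y ∈ orbitTypeStratum x := by
  have h1 := hS.subset_connectedComponentIn hz
    (F := {y : M | MulAction.stabilizer Circle y = MulAction.stabilizer Circle x}) hst
  have h2 := connectedComponentIn_eq (hzx : z ∈ connectedComponentIn _ x)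
  change y ∈ connectedComponentIn _ x
  rw [h2]
  exact h1 hy

end

section

variable {E : Type*} [NormedAddCommGroup E] [NormedSpace ℝ E] [FiniteDimensional ℝ E]
  {M : Type*} [TopologicalSpace M]
  [ChartedSpace E M] [IsManifold 𝓘(ℝ, E) ∞ M]
  [MulAction Circle M] [ContMDiffSMul (𝓡 1) 𝓘(ℝ, E) ∞ Circle M]

theorem exists_isLinearizingChart {g : Circle} (hg : IsOfFinOrder g) {z : M} (hz : g • z = z) :
    ∃ (A : E →L[ℝ] E) (e : OpenPartialHomeomorph M E), IsLinearizingChart g z A e := by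
  obtain ⟨n, hn, hgn⟩ := isOfFinOrder_iff_pow_eq_one.1 hg
  obtain ⟨A, e, h1, h2, h3, h4, h5⟩ := exists_linearizing_chart (E := E) hn hgn hz
  exact ⟨A, e, h1, h2, h3, h4, h5⟩

/-- If `A` is near `z` the set of fixed points of an element of finite order, its tangent space at
`z` is the space of fixed tangent vectors: lines in a linearizing chart realize all of these as
velocities. -/
theorem mem_tangentTo_iff_isotropyEnd_eq {g : Circle} (hg : IsOfFinOrder g) {A : Set M} {z : M}
    (hz : g • z = z) (hA : ∀ y ∈ A, g • y = y) (hA' : ∀ᶠ y in 𝓝 z, g • y = y → y ∈ A) (v : E) :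
    v ∈ tangentTo E A z ↔ isotropyEnd E g z v = v := by
  refine ⟨isotropyEnd_eq_of_mem_tangentTo hA, fun hv => ?_⟩
  obtain ⟨B, e, he⟩ := exists_isLinearizingChart (E := E) hg hz
  obtain ⟨L, hL, hconj⟩ := he.eventually_conj.self_of_nhds hz
  have hBv : B (L v) = L v := by rw [← hconj, hv]
  obtain ⟨h1, h2⟩ := he.line hL v
  refine Submodule.subset_span ⟨fun t => e.symm (t • L v), ?_, ?_, h2⟩
  · simp only [zero_smul]
    exact he.symm_zero
  · have hline : Filter.Tendsto (fun t : ℝ => t • L v) (𝓝 0) (𝓝 0) := by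
      have : Continuous fun t : ℝ => t • L v := by fun_prop
      simpa using this.tendsto 0
    have h3 : ∀ᶠ u in 𝓝 (0 : E), B u = u → e.symm u ∈ A := by
      filter_upwards [e.open_target.eventually_mem he.zero_mem_target,
        he.tendsto_symm.eventually (he.eventually_smul_eq_iff hz),
        he.tendsto_symm.eventually hA'] with u hu hu1 hu2 hBu
      exact hu2 (hu1.2 (by rw [e.right_inv hu, hBu]))
    filter_upwards [h1, hline.eventually h3] with t ht ht3
    exact ⟨ht3 (by rw [map_smul, hBv]), ht⟩

theorem tangentTo_univ (z : M) : tangentTo E (Set.univ : Set M) z = ⊤ := by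
  refine Submodule.eq_top_iff'.2 fun v : E => ?_
  refine (mem_tangentTo_iff_isotropyEnd_eq (IsOfFinOrder.one (G := Circle)) (one_smul _ z)
    (fun y _ => one_smul _ y) (Filter.Eventually.of_forall fun _ _ => trivial) v).2 ?_
  rw [isotropyEnd_one]
  rfl

/-- The multiplicities of the eigenvalues of the isotropy endomorphism are locally constant along
the fixed points. -/
theorem eventually_finrank_eigenspace_eq {g : Circle} (hg : IsOfFinOrder g) {z : M}
    (hz : g • z = z) (μ : ℝ) :
    ∀ᶠ y in 𝓝 z, g • y = y → Module.finrank ℝ ((isotropyEnd E g y).eigenspace μ) =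
      Module.finrank ℝ ((isotropyEnd E g z).eigenspace μ) := by
  obtain ⟨B, e, he⟩ := exists_isLinearizingChart (E := E) hg hz
  have key : ∀ᶠ y in 𝓝 z, g • y = y → Module.finrank ℝ ((isotropyEnd E g y).eigenspace μ) =
      Module.finrank ℝ (Module.End.eigenspace (B : E →ₗ[ℝ] E) μ) := by
    filter_upwards [he.eventually_conj] with y hy hgy
    obtain ⟨L, -, hL⟩ := hy hgy
    have hmap : Submodule.map (L : E →ₗ[ℝ] E) ((isotropyEnd E g y).eigenspace μ) =
        Module.End.eigenspace (B : E →ₗ[ℝ] E) μ := by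
      ext w
      obtain ⟨v, rfl⟩ := L.surjective w
      rw [Module.End.mem_eigenspace_iff, ContinuousLinearMap.coe_coe, ← hL, ← map_smul,
        L.injective.eq_iff, ← Module.End.mem_eigenspace_iff]
      exact (Submodule.mem_map_equiv (e := L) _).trans (by rw [LinearEquiv.symm_apply_apply])
    rw [← hmap]
    exact (LinearEquiv.finrank_map_eq L _).symm
  filter_upwards [key] with y hy hgy
  rw [hy hgy, key.self_of_nhds hz]

theorem finrank_eigenspace_eq_of_isPreconnected {g : Circle} (hg : IsOfFinOrder g) {S : Set M}
    (hS : IsPreconnected S) (hgS : ∀ y ∈ S, g • y = y) (μ : ℝ) {x y : M} (hx : x ∈ S)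
    (hy : y ∈ S) :
    Module.finrank ℝ ((isotropyEnd E g x).eigenspace μ) =
      Module.finrank ℝ ((isotropyEnd E g y).eigenspace μ) := by
  refine eq_of_isPreconnected_of_eventually hS
    (f := fun y => Module.finrank ℝ ((isotropyEnd E g y).eigenspace μ)) (fun z hz => ?_) hx hy
  filter_upwards [eventually_finrank_eigenspace_eq (E := E) hg (hgS z hz) μ] with y h hyS
  exact h (hgS y hyS)

/-- For large `m`, the points near `z` that are fixed by the element `exp (2 π i / 3 ^ m)` of order
`3 ^ m` are fixed by the whole circle. -/
theorem eventually_smul_eq_imp_stabilizer_eq_top (E : Type*) [NormedAddCommGroup E]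
    [NormedSpace ℝ E] [FiniteDimensional ℝ E] {M : Type*} [TopologicalSpace M]
    [ChartedSpace E M] [IsManifold 𝓘(ℝ, E) ∞ M] [MulAction Circle M]
    [ContMDiffSMul (𝓡 1) 𝓘(ℝ, E) ∞ Circle M] (z : M) :
    ∃ k : ℕ, ∀ m ≥ k, ∀ᶠ y in 𝓝 z, Circle.exp (2 * Real.pi / 3 ^ m) • y = y →
      MulAction.stabilizer Circle y = ⊤ := by
  obtain ⟨ε, hε, h⟩ := eventually_stabilizer_eq_top_of_small_period E z
  obtain ⟨k, hk⟩ := pow_unbounded_of_one_lt (2 * Real.pi / ε) (by norm_num : (1 : ℝ) < 3)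
  refine ⟨k, fun m hm => ?_⟩
  filter_upwards [h] with y hy
  refine hy _ ⟨by positivity, ?_⟩
  have h1 : (3 : ℝ) ^ k ≤ 3 ^ m := pow_le_pow_right₀ (by norm_num) hm
  rw [div_lt_iff₀ (by positivity)]
  rw [div_lt_iff₀ hε] at hk
  nlinarith

/-- If an element of finite order determines the orbit type near a point of a stratum, then the
stratum is locally the set of its fixed points. -/
theorem eventually_smul_eq_imp_mem_orbitTypeStratum (E : Type*) [NormedAddCommGroup E]
    [NormedSpace ℝ E] [FiniteDimensional ℝ E] {M : Type*} [TopologicalSpace M]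
    [ChartedSpace E M] [IsManifold 𝓘(ℝ, E) ∞ M] [MulAction Circle M]
    [ContMDiffSMul (𝓡 1) 𝓘(ℝ, E) ∞ Circle M] [ContinuousSMul Circle M] {g : Circle}
    (hg : IsOfFinOrder g) {x z : M}
    (hzx : z ∈ orbitTypeStratum x) (hz : g • z = z)
    (hst : ∀ᶠ y in 𝓝 z, g • y = y →
      MulAction.stabilizer Circle y = MulAction.stabilizer Circle z) :
    ∀ᶠ y in 𝓝 z, g • y = y → y ∈ orbitTypeStratum x := by
  obtain ⟨B, e, he⟩ := exists_isLinearizingChart (E := E) hg hz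
  obtain ⟨r, hr, hball, hev⟩ := he.exists_ball ((he.eventually_smul_eq_iff hz).and hst)
  filter_upwards [hev, he.eventually_smul_eq_iff hz] with y ⟨hys, hyr⟩ hy hgy
  have hsub : segment ℝ 0 (e y) ⊆ Metric.ball (0 : E) r :=
    (convex_ball _ _).segment_subset (Metric.mem_ball_self hr) hyr
  have hfix : ∀ u ∈ segment ℝ 0 (e y), B u = u := by
    rintro u ⟨a, b, -, -, -, rfl⟩
    rw [map_add, map_smul, map_smul, map_zero, hy.1 hgy]
  have hcont : ContinuousOn e.symm (segment ℝ 0 (e y)) :=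
    e.continuousOn_symm.mono fun u hu => (hball u (hsub hu)).1
  -- the segment from `0` to `e y` joins `z` to `y` through points of the same orbit type
  refine mem_orbitTypeStratum_of_isPreconnected
    ((convex_segment 0 (e y)).isPreconnected.image _ hcont) ?_
    ⟨0, left_mem_segment _ _ _, he.symm_zero⟩ ⟨e y, right_mem_segment _ _ _, e.left_inv hys⟩ hzx
  rintro _ ⟨u, hu, rfl⟩
  obtain ⟨hut, hu1, hu2⟩ := hball u (hsub hu)
  rw [hu2 (hu1.2 (by rw [e.right_inv hut, hfix u hu]))]
  exact stabilizer_eq_of_mem_orbitTypeStratum hzx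

theorem eventually_stabilizer_le_of_eq_zpowers (E : Type*) [NormedAddCommGroup E]
    [NormedSpace ℝ E] [FiniteDimensional ℝ E] {M : Type*} [TopologicalSpace M] [T2Space M]
    [ChartedSpace E M] [IsManifold 𝓘(ℝ, E) ∞ M] [MulAction Circle M]
    [ContMDiffSMul (𝓡 1) 𝓘(ℝ, E) ∞ Circle M] {ζ : Circle} (hζ : IsOfFinOrder ζ) {z : M}
    (hz : MulAction.stabilizer Circle z = Subgroup.zpowers ζ) :
    ∀ᶠ y in 𝓝 z, MulAction.stabilizer Circle y ≤ MulAction.stabilizer Circle z := by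
  obtain ⟨n, hn, hζn⟩ := isOfFinOrder_iff_pow_eq_one.1 hζ
  refine eventually_stabilizer_le E hn fun g hg => ?_
  rw [hz] at hg
  obtain ⟨k, rfl⟩ := hg
  simp only
  rw [← zpow_natCast, ← zpow_mul, mul_comm, zpow_mul, zpow_natCast, hζn, one_zpow]

/-- Along every stratum, some element of finite order of the stabilizer cuts out the tangent space
of the stratum. If the stabilizer is finite, its generator does; if it is the whole circle, an
element of large order `3 ^ m` does. -/
theorem exists_isOfFinOrder_forall_mem_tangentTo_iff (E : Type*) [NormedAddCommGroup E]
    [NormedSpace ℝ E] [FiniteDimensional ℝ E] {M : Type*} [TopologicalSpace M] [T2Space M]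
    [ChartedSpace E M] [IsManifold 𝓘(ℝ, E) ∞ M] [MulAction Circle M]
    [ContMDiffSMul (𝓡 1) 𝓘(ℝ, E) ∞ Circle M] [ContinuousSMul Circle M] (x : M) :
    ∃ ζ : Circle, IsOfFinOrder ζ ∧ ζ • x = x ∧
      (∀ z ∈ orbitTypeStratum x, ∀ v : E,
        v ∈ tangentTo E (orbitTypeStratum x : Set M) z ↔ isotropyEnd E ζ z v = v) ∧
      (MulAction.stabilizer Circle x = Subgroup.zpowers ζ ∨ Odd (orderOf ζ)) := by
  have hfix : ∀ g : Circle, g • x = x → ∀ z ∈ orbitTypeStratum x, g • z = z := by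
    intro g hg z hz
    rw [← MulAction.mem_stabilizer_iff, stabilizer_eq_of_mem_orbitTypeStratum hz]
    exact hg
  by_cases htop : MulAction.stabilizer Circle x = ⊤
  · have hall : ∀ g : Circle, g • x = x := fun g => by
      rw [← MulAction.mem_stabilizer_iff, htop]; trivial
    let c : ℕ → Circle := fun m => Circle.exp (2 * Real.pi / 3 ^ m)
    have hc3 : ∀ m k, c (m + k) ^ 3 ^ k = c m := fun m k => by
      simp only [c]
      rw [← Circle.exp_natCast_mul]
      congr 1
      push_cast
      field_simp
      ring
    have hcpow : ∀ m, c m ^ 3 ^ m = 1 := fun m => by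
      have := hc3 0 m
      rw [zero_add] at this
      rw [this]
      simp [c]
    have hcfin : ∀ m, IsOfFinOrder (c m) := fun m =>
      isOfFinOrder_iff_pow_eq_one.2 ⟨3 ^ m, by positivity, hcpow m⟩
    -- `c m` is a power of `c (m + k)`, so it fixes at least as many vectors
    have hle : ∀ z ∈ orbitTypeStratum x, ∀ m k, (isotropyEnd E (c (m + k)) z).eigenspace 1 ≤
        (isotropyEnd E (c m) z).eigenspace 1 := by
      intro z hz m k v hv
      rw [Module.End.mem_eigenspace_iff, one_smul] at hv ⊢
      rw [← hc3 m k, isotropyEnd_pow (hfix _ (hall _) z hz), Module.End.pow_apply]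
      exact Function.iterate_fixed hv _
    let d : ℕ → ℕ := fun m => Module.finrank ℝ ((isotropyEnd E (c m) x).eigenspace 1)
    -- the dimensions decrease, so they are eventually minimal
    obtain ⟨m, hm⟩ : ∃ m, ∀ k, d m ≤ d k := by
      obtain ⟨_, ⟨m, rfl⟩, h⟩ := WellFounded.has_min (wellFounded_lt (α := ℕ)) (Set.range d)
        ⟨_, 0, rfl⟩
      exact ⟨m, fun k => not_lt.1 (h (d k) ⟨k, rfl⟩)⟩
    refine ⟨c m, hcfin m, hall _, fun z hz v => ?_, Or.inr ?_⟩
    · -- at `z`, the fixed spaces of `c m` and of `c (m + k)` agree, and near `z` the fixed points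
      -- of `c (m + k)` are those of the circle
      obtain ⟨k, hk⟩ := eventually_smul_eq_imp_stabilizer_eq_top E z
      have hd : ∀ j, Module.finrank ℝ ((isotropyEnd E (c j) z).eigenspace 1) = d j := fun j =>
        finrank_eigenspace_eq_of_isPreconnected (hcfin j) (isPreconnected_orbitTypeStratum x)
          (fun y hy => hfix _ (hall _) y hy) 1 hz (mem_orbitTypeStratum_self x)
      have heq := Submodule.eq_of_le_of_finrank_le (hle z hz m k) (by rw [hd, hd]; exact hm _)
      have hmem : isotropyEnd E (c m) z v = v ↔ isotropyEnd E (c (m + k)) z v = v := by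
        have := SetLike.ext_iff.1 heq v
        rw [Module.End.mem_eigenspace_iff, Module.End.mem_eigenspace_iff, one_smul] at this
        exact this.symm
      rw [hmem]
      refine mem_tangentTo_iff_isotropyEnd_eq (hcfin _) (hfix _ (hall _) z hz)
        (fun y hy => hfix _ (hall _) y hy) ?_ v
      refine eventually_smul_eq_imp_mem_orbitTypeStratum E (hcfin (m + k)) hz
        (hfix _ (hall _) z hz) ?_
      filter_upwards [hk (m + k) (by omega)] with y hy hcy
      rw [hy hcy, stabilizer_eq_of_mem_orbitTypeStratum hz, htop]
    · exact Odd.of_dvd_nat (Odd.pow (by decide)) (orderOf_dvd_of_pow_eq_one (hcpow m))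
  · have hclosed : IsClosed (MulAction.stabilizer Circle x : Set Circle) :=
      isClosed_eq (f := fun g : Circle => g • x) (g := fun _ => x) (by fun_prop) continuous_const
    obtain ⟨ζ, hζ, hst⟩ := eq_zpowers_of_isClosed hclosed htop
    have hζx : ζ • x = x := by
      rw [← MulAction.mem_stabilizer_iff, hst]
      exact Subgroup.mem_zpowers ζ
    refine ⟨ζ, hζ, hζx, fun z hz v => ?_, Or.inl hst⟩
    refine mem_tangentTo_iff_isotropyEnd_eq hζ (hfix _ hζx z hz)
      (fun y hy => hfix _ hζx y hy) ?_ v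
    refine eventually_smul_eq_imp_mem_orbitTypeStratum E hζ hz (hfix _ hζx z hz) ?_
    have hstz := (stabilizer_eq_of_mem_orbitTypeStratum hz).trans hst
    filter_upwards [eventually_stabilizer_le_of_eq_zpowers E hζ hstz] with y hy hζy
    refine le_antisymm hy ?_
    rw [hstz, Subgroup.zpowers_le]
    exact hζy

end

/-! ### The stratum of index two -/

section

variable {M : Type*} [MulAction Circle M]

theorem stabilizer_eq_zpowers_sq {ζ : Circle} {y : M}
    (hle : MulAction.stabilizer Circle y ≤ Subgroup.zpowers ζ) (h2 : ζ ^ 2 • y = y)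
    (h1 : ζ • y ≠ y) : MulAction.stabilizer Circle y = Subgroup.zpowers (ζ ^ 2) := by
  refine le_antisymm (fun g hg => ?_) (by rw [Subgroup.zpowers_le]; exact h2)
  obtain ⟨k, rfl⟩ := hle hg
  have hp : ∀ j : ℤ, ζ ^ (2 * j) ∈ Subgroup.zpowers (ζ ^ 2) := fun j =>
    ⟨j, by simp only [zpow_mul]; rfl⟩
  rcases Int.even_or_odd' k with ⟨j, rfl | rfl⟩
  · exact hp j
  · exfalso
    have h3 : ζ ^ (2 * j) ∈ MulAction.stabilizer Circle y := by
      have h4 : Subgroup.zpowers (ζ ^ 2) ≤ MulAction.stabilizer Circle y := by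
        rw [Subgroup.zpowers_le]; exact h2
      exact h4 (hp j)
    simp only [zpow_add_one] at hg
    exact h1 ((Subgroup.mul_mem_cancel_left _ h3).1 hg)

theorem relIndex_stabilizer_eq_two {ζ : Circle} {x y : M}
    (hx : MulAction.stabilizer Circle x = Subgroup.zpowers ζ) (h2 : ζ ^ 2 • y = y)
    (h1 : ζ • y ≠ y) :
    (MulAction.stabilizer Circle y).relIndex (MulAction.stabilizer Circle x) = 2 := by
  rw [hx, Subgroup.relIndex_eq_two_iff_exists_notMem_and]
  refine ⟨ζ, Subgroup.mem_zpowers ζ, h1, ?_⟩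
  rintro _ ⟨k, rfl⟩
  have hp : ∀ j : ℤ, ζ ^ (2 * j) ∈ MulAction.stabilizer Circle y := fun j => by
    rw [zpow_mul]
    exact Subgroup.zpow_mem _ (show ζ ^ (2 : ℤ) ∈ MulAction.stabilizer Circle y from h2) j
  rcases Int.even_or_odd' k with ⟨j, rfl | rfl⟩
  · exact Or.inr (hp j)
  · refine Or.inl ?_
    have := hp (j + 1)
    simp only
    rwa [← zpow_add_one, show 2 * j + 1 + 1 = 2 * (j + 1) by ring]

end

section

variable {E : Type*} [NormedAddCommGroup E] [NormedSpace ℝ E]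
  {M : Type*} [TopologicalSpace M] [ChartedSpace E M]
  [MulAction Circle M] [ContMDiffSMul (𝓡 1) 𝓘(ℝ, E) ∞ Circle M]

theorem IsLinearizingChart.sq {g : Circle} {z : M} {A : E →L[ℝ] E} {e : OpenPartialHomeomorph M E}
    (he : IsLinearizingChart g z A e) (hz : g • z = z) :
    IsLinearizingChart (g ^ 2) z (A.comp A) e where
  mem_source := he.mem_source
  map_eq_zero := he.map_eq_zero
  contMDiffOn := he.contMDiffOn
  contMDiffOn_symm := he.contMDiffOn_symm
  eventually_map_smul := by
    have hg : Filter.Tendsto (fun y : M => g • y) (𝓝 z) (𝓝 z) := by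
      have := (contMDiff_smul_left E (M := M) g).continuous.tendsto z
      rwa [hz] at this
    filter_upwards [he.eventually_map_smul, hg.eventually he.eventually_map_smul] with y h1 h2
    rw [pow_two, mul_smul, h2, h1]
    rfl

end

/-- Two vectors on which `B` acts as an involution, neither of them fixed: one of the segments from
`a` to `b` and from `a` to `B b` avoids the fixed vectors. -/
theorem forall_segment_ne_or_forall_segment_ne {E : Type*} [AddCommGroup E] [Module ℝ E]
    {B : E →ₗ[ℝ] E} {a b : E} (hb : B (B b) = b) (ha' : B a ≠ a)
    (hb' : B b ≠ b) :
    (∀ u ∈ segment ℝ a b, B u ≠ u) ∨ ∀ u ∈ segment ℝ a (B b), B u ≠ u := by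
  by_contra! h
  obtain ⟨⟨_, ⟨s, t, hs, ht, hst, rfl⟩, h1⟩, ⟨_, ⟨s', t', hs', ht', hst', rfl⟩, h2⟩⟩ := h
  have ha1 : B a - a ≠ 0 := sub_ne_zero.2 ha'
  have hb1 : B b - b ≠ 0 := sub_ne_zero.2 hb'
  have e1 : s • (B a - a) + t • (B b - b) = 0 := by
    rw [map_add, map_smul, map_smul] at h1
    rw [← sub_eq_zero] at h1
    rw [← h1]
    module
  have e2 : s' • (B a - a) - t' • (B b - b) = 0 := by
    rw [map_add, map_smul, map_smul, hb] at h2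
    rw [← sub_eq_zero] at h2
    rw [← h2]
    module
  have e3 : (s * t' + t * s') • (B a - a) = 0 := by
    have : (s * t' + t * s') • (B a - a) =
        t' • (s • (B a - a) + t • (B b - b)) + t • (s' • (B a - a) - t' • (B b - b)) := by module
    rw [this, e1, e2, smul_zero, smul_zero, add_zero]
  have e4 : (s * t' + t * s') • (B b - b) = 0 := by
    have : (s * t' + t * s') • (B b - b) =
        s' • (s • (B a - a) + t • (B b - b)) - s • (s' • (B a - a) - t' • (B b - b)) := by module
    rw [this, e1, e2, smul_zero, smul_zero, sub_zero]
  have e5 : s * t' + t * s' = 0 := (smul_eq_zero.1 e3).resolve_right ha1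
  have h5 : s * t' = 0 := by nlinarith [mul_nonneg hs ht', mul_nonneg ht hs']
  have h6 : t * s' = 0 := by nlinarith [mul_nonneg hs ht', mul_nonneg ht hs']
  rcases mul_eq_zero.1 h5 with h0 | h0
  · rw [h0, zero_add] at hst
    rw [h0, hst, zero_smul, one_smul, zero_add] at e1
    exact hb1 e1
  · rw [h0, add_zero] at hst'
    rw [h0, hst', zero_smul, one_smul, sub_zero] at e2
    exact ha1 e2

/-- Near a point with stabilizer generated by `ζ`, the points fixed by `ζ ^ 2` but not by `ζ` lie
in a single stratum. In a linearizing chart, they may form two half spaces, but `ζ` swaps these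
and preserves every stratum. -/
theorem eventually_mem_orbitTypeStratum_prod (E : Type*) [NormedAddCommGroup E]
    [NormedSpace ℝ E] [FiniteDimensional ℝ E] {M : Type*} [TopologicalSpace M] [T2Space M]
    [ChartedSpace E M] [IsManifold 𝓘(ℝ, E) ∞ M] [MulAction Circle M]
    [ContMDiffSMul (𝓡 1) 𝓘(ℝ, E) ∞ Circle M] [ContinuousSMul Circle M] {ζ : Circle}
    (hζ : IsOfFinOrder ζ) {z : M}
    (hz : MulAction.stabilizer Circle z = Subgroup.zpowers ζ) :
    ∀ᶠ p : M × M in 𝓝 z ×ˢ 𝓝 z, (ζ ^ 2 • p.1 = p.1 ∧ ζ • p.1 ≠ p.1) →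
      (ζ ^ 2 • p.2 = p.2 ∧ ζ • p.2 ≠ p.2) → p.2 ∈ orbitTypeStratum p.1 := by
  have hζz : ζ • z = z := by
    rw [← MulAction.mem_stabilizer_iff, hz]; exact Subgroup.mem_zpowers ζ
  obtain ⟨B, e, he⟩ := exists_isLinearizingChart (E := E) hζ hζz
  have he2 := he.sq hζz
  have hζ2z : ζ ^ 2 • z = z := by rw [pow_two, mul_smul, hζz, hζz]
  have hle := eventually_stabilizer_le_of_eq_zpowers E hζ hz
  rw [hz] at hle
  obtain ⟨r, hr, hball, hev⟩ := he.exists_ball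
    (((he.eventually_smul_eq_iff hζz).and (he2.eventually_smul_eq_iff hζ2z)).and hle)
  have hstab : ∀ u ∈ Metric.ball (0 : E) r, B (B u) = u → B u ≠ u →
      MulAction.stabilizer Circle (e.symm u) = Subgroup.zpowers (ζ ^ 2) := by
    intro u hu h2 h1
    obtain ⟨hut, ⟨hu1, hu2⟩, hu3⟩ := hball u hu
    rw [e.right_inv hut] at hu1 hu2
    exact stabilizer_eq_zpowers_sq hu3 (hu2.2 h2) fun h => h1 (hu1.1 h)
  -- the segment between two vectors of the chart joins the corresponding points
  have path : ∀ a ∈ e.source, ∀ b ∈ e.source, e a ∈ Metric.ball (0 : E) r →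
      e b ∈ Metric.ball (0 : E) r → B (B (e a)) = e a → B (B (e b)) = e b →
      (∀ u ∈ segment ℝ (e a) (e b), B u ≠ u) → b ∈ orbitTypeStratum a := by
    intro a has b hbs ha hb ha2 hb2 hseg
    have hsub : segment ℝ (e a) (e b) ⊆ Metric.ball (0 : E) r :=
      (convex_ball _ _).segment_subset ha hb
    have hst : ∀ u ∈ segment ℝ (e a) (e b),
        MulAction.stabilizer Circle (e.symm u) = Subgroup.zpowers (ζ ^ 2) := by
      intro u hu
      refine hstab u (hsub hu) ?_ (hseg u hu)
      obtain ⟨s, t, -, -, -, rfl⟩ := hu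
      simp only [map_add, map_smul, ha2, hb2]
    refine mem_orbitTypeStratum_of_isPreconnected (S := e.symm '' segment ℝ (e a) (e b))
      ((convex_segment _ _).isPreconnected.image _
        (e.continuousOn_symm.mono fun u hu => (hball u (hsub hu)).1)) ?_
      ⟨e a, left_mem_segment _ _ _, e.left_inv has⟩ ⟨e b, right_mem_segment _ _ _, e.left_inv hbs⟩
      (mem_orbitTypeStratum_self a)
    rintro _ ⟨u, hu, rfl⟩
    have h3 := hst _ (left_mem_segment ℝ (e a) (e b))
    rw [e.left_inv has] at h3
    rw [hst u hu, h3]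
  have hcont : Filter.Tendsto (fun y : M => ζ • y) (𝓝 z) (𝓝 z) := by
    have := (continuous_const_smul (T := M) ζ).tendsto z
    rwa [hζz] at this
  have hU : ∀ᶠ y in 𝓝 z, (y ∈ e.source ∧ e y ∈ Metric.ball (0 : E) r) ∧
      (ζ • y ∈ e.source ∧ e (ζ • y) ∈ Metric.ball (0 : E) r) ∧ e (ζ • y) = B (e y) ∧
      (ζ • y = y ↔ B (e y) = e y) ∧ (ζ ^ 2 • y = y ↔ B (B (e y)) = e y) := by
    filter_upwards [hev, hcont.eventually hev, he.eventually_map_smul,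
      he.eventually_smul_eq_iff hζz, he2.eventually_smul_eq_iff hζ2z] with y a1 a2 a3 a4 a5
    exact ⟨a1, a2, a3, a4, a5⟩
  filter_upwards [hU.prod_mk hU] with ⟨a, b⟩ ⟨⟨⟨has, ha⟩, _, _, ha1, ha2⟩,
    ⟨⟨hbs, hb⟩, ⟨hbs', hb'⟩, hbB, hb1, hb2⟩⟩ ⟨hFa2, hFa1⟩ ⟨hFb2, hFb1⟩
  simp only at *
  rw [ha2] at hFa2
  rw [hb2] at hFb2
  rcases forall_segment_ne_or_forall_segment_ne (B := (B : E →ₗ[ℝ] E)) (a := e a) (b := e b)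
    hFb2 (fun h => hFa1 (ha1.2 h)) (fun h => hFb1 (hb1.2 h)) with h | h
  · exact path a has b hbs ha hb hFa2 hFb2 h
  · have h3 : ζ • b ∈ orbitTypeStratum a := by
      refine path a has (ζ • b) hbs' ha hb' hFa2 ?_ ?_
      · rw [hbB, hFb2]
      · rw [hbB]; exact h
    have := (orbitTypeStratum a).smul_mem ζ⁻¹ h3
    rwa [inv_smul_smul] at this

/-- If `-1` is an eigenvalue of the isotropy endomorphism of `ζ` at `z`, there are points
arbitrarily near `z` that are fixed by `ζ ^ 2` but not by `ζ`. -/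
theorem frequently_smul_sq_eq (E : Type*) [NormedAddCommGroup E]
    [NormedSpace ℝ E] [FiniteDimensional ℝ E] {M : Type*} [TopologicalSpace M]
    [ChartedSpace E M] [IsManifold 𝓘(ℝ, E) ∞ M] [MulAction Circle M]
    [ContMDiffSMul (𝓡 1) 𝓘(ℝ, E) ∞ Circle M] {ζ : Circle} (hζ : IsOfFinOrder ζ) {z : M}
    (hz : ζ • z = z)
    (hne : (isotropyEnd E ζ z).eigenspace (-1) ≠ ⊥) :
    ∃ᶠ y in 𝓝 z, ζ ^ 2 • y = y ∧ ζ • y ≠ y := by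
  obtain ⟨v, hv, hv0⟩ := (Submodule.ne_bot_iff _).1 hne
  rw [Module.End.mem_eigenspace_iff, neg_one_smul] at hv
  obtain ⟨B, e, he⟩ := exists_isLinearizingChart (E := E) hζ hz
  obtain ⟨L, -, hL⟩ := he.eventually_conj.self_of_nhds hz
  have hBv : B (L v) = -L v := by rw [← hL, hv, map_neg]
  have hLv : L v ≠ 0 := by simpa using hv0
  have hζ2z : ζ ^ 2 • z = z := by rw [pow_two, mul_smul, hz, hz]
  have hline : Filter.Tendsto (fun t : ℝ => t • L v) (𝓝[≠] 0) (𝓝 0) := by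
    have : Continuous fun t : ℝ => t • L v := by fun_prop
    simpa using (this.tendsto 0).mono_left nhdsWithin_le_nhds
  refine (he.tendsto_symm.comp hline).frequently (Filter.Eventually.frequently ?_)
  filter_upwards [hline.eventually (e.open_target.eventually_mem he.zero_mem_target),
    (he.tendsto_symm.comp hline).eventually (he.eventually_smul_eq_iff hz),
    (he.tendsto_symm.comp hline).eventually ((he.sq hz).eventually_smul_eq_iff hζ2z),
    self_mem_nhdsWithin] with t ht h1 h2 ht0
  simp only [Function.comp_apply] at h1 h2 ⊢
  rw [e.right_inv ht] at h1 h2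
  have hBt : B (t • L v) = -(t • L v) := by rw [map_smul, hBv, smul_neg]
  refine ⟨h2.2 ?_, fun h => ?_⟩
  · rw [ContinuousLinearMap.comp_apply, hBt, map_neg, hBt, neg_neg]
  · have h3 := h1.1 h
    rw [hBt] at h3
    refine smul_ne_zero (two_ne_zero (α := ℝ)) (smul_ne_zero ht0 hLv) ?_
    rw [two_smul]
    nth_rewrite 1 [← h3]
    exact neg_add_cancel _

/-- If the stabilizer of the stratum `X` of `x` is generated by `ζ` and `-1` is an eigenvalue of the
isotropy endomorphism of `ζ`, then `X` lies in the closure of a stratum with stabilizer of index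
`2`, and the tangent spaces of that closure along `X` are the fixed spaces of `ζ ^ 2`. -/
theorem exists_stratum_of_index_two (E : Type*) [NormedAddCommGroup E]
    [NormedSpace ℝ E] [FiniteDimensional ℝ E] {M : Type*} [TopologicalSpace M] [T2Space M]
    [ChartedSpace E M] [IsManifold 𝓘(ℝ, E) ∞ M] [MulAction Circle M]
    [ContMDiffSMul (𝓡 1) 𝓘(ℝ, E) ∞ Circle M] [ContinuousSMul Circle M] {ζ : Circle}
    (hζ : IsOfFinOrder ζ) {x : M}
    (hx : MulAction.stabilizer Circle x = Subgroup.zpowers ζ)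
    (hne : (isotropyEnd E ζ x).eigenspace (-1) ≠ ⊥) :
    ∃ y : M, orbitTypeStratum x ≠ orbitTypeStratum y ∧
      (orbitTypeStratum x : Set M) ⊆ closure (orbitTypeStratum y : Set M) ∧
      (MulAction.stabilizer Circle y).relIndex (MulAction.stabilizer Circle x) = 2 ∧
      ∀ z ∈ orbitTypeStratum x, ∀ v : E,
        v ∈ tangentTo E (closure (orbitTypeStratum y : Set M)) z ↔
          isotropyEnd E ζ z (isotropyEnd E ζ z v) = v := by
  let F : M → Prop := fun y => ζ ^ 2 • y = y ∧ ζ • y ≠ y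
  have hst : ∀ z ∈ orbitTypeStratum x, MulAction.stabilizer Circle z = Subgroup.zpowers ζ :=
    fun z hz => (stabilizer_eq_of_mem_orbitTypeStratum hz).trans hx
  have hfix : ∀ z ∈ orbitTypeStratum x, ζ • z = z := fun z hz => by
    rw [← MulAction.mem_stabilizer_iff, hst z hz]; exact Subgroup.mem_zpowers ζ
  have hx0 := mem_orbitTypeStratum_self x
  have hfreq : ∀ z ∈ orbitTypeStratum x, ∃ᶠ y in 𝓝 z, F y := by
    intro z hz
    refine frequently_smul_sq_eq E hζ (hfix z hz) fun h0 => hne ?_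
    have := finrank_eigenspace_eq_of_isPreconnected (E := E) hζ (isPreconnected_orbitTypeStratum x)
      hfix (-1) hx0 hz
    rw [h0, finrank_bot] at this
    exact Submodule.finrank_eq_zero.1 this
  have hlocal : ∀ z ∈ orbitTypeStratum x, ∃ U ∈ 𝓝 z, ∀ a ∈ U, ∀ b ∈ U, F a → F b →
      b ∈ orbitTypeStratum a := by
    intro z hz
    obtain ⟨U, hU, h⟩ := Filter.eventually_prod_self_iff
      (r := fun a b => F a → F b → b ∈ orbitTypeStratum a) |>.1
      (eventually_mem_orbitTypeStratum_prod E hζ (hst z hz))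
    exact ⟨U, hU, fun a ha b hb => h a ha b hb⟩
  have hmem : ∀ {a b c : M}, a ∈ orbitTypeStratum b → c ∈ orbitTypeStratum a →
      c ∈ orbitTypeStratum b := by
    intro a b c ha hc
    refine mem_orbitTypeStratum_of_isPreconnected (isPreconnected_orbitTypeStratum a)
      (fun w hw => ?_) (mem_orbitTypeStratum_self a) hc ha
    rw [stabilizer_eq_of_mem_orbitTypeStratum hw, stabilizer_eq_of_mem_orbitTypeStratum ha]
  obtain ⟨U₀, hU₀, hlocal₀⟩ := hlocal x hx0
  obtain ⟨y, hFy, hyU⟩ := ((hfreq x hx0).and_eventually hU₀).exists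
  -- near every point of the stratum, the points satisfying `F` are in the stratum of `y`
  have hR : ∀ z ∈ orbitTypeStratum x, ∀ᶠ w in 𝓝 z, F w → w ∈ orbitTypeStratum y := by
    intro z hz
    have hRx : ∀ᶠ w in 𝓝 x, F w → w ∈ orbitTypeStratum y := by
      filter_upwards [hU₀] with w hw hFw
      exact hlocal₀ y hyU w hw hFy hFw
    refine (eq_of_isPreconnected_of_eventually (isPreconnected_orbitTypeStratum x)
      (f := fun z => ∀ᶠ w in 𝓝 z, F w → w ∈ orbitTypeStratum y) (fun z hz => ?_) hx0 hz).mp hRx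
    obtain ⟨U, hU, hUF⟩ := hlocal z hz
    -- the property is open; so is its failure, since near `z` all points satisfying `F` lie in one
    -- stratum and such points accumulate at every point of the stratum of `x`
    by_cases hRz : ∀ᶠ w in 𝓝 z, F w → w ∈ orbitTypeStratum y
    · filter_upwards [hRz.eventually_nhds] with z' hz' _
      exact propext ⟨fun _ => hRz, fun _ => hz'⟩
    · filter_upwards [eventually_mem_nhds_iff.2 hU] with z' hz' hz'X
      refine propext ⟨fun h => ?_, fun h => absurd h hRz⟩
      obtain ⟨a, hFa, ha, haU⟩ := ((hfreq z' hz'X).and_eventually (h.and hz')).exists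
      filter_upwards [hU] with b hb hFb
      exact hmem (ha hFa) (hUF a haU b hb hFa hFb)
  have hcl : (orbitTypeStratum x : Set M) ⊆ closure (orbitTypeStratum y : Set M) := by
    intro z hz
    rw [mem_closure_iff_frequently]
    exact ((hfreq z hz).and_eventually (hR z hz)).mono fun w hw => hw.2 hw.1
  refine ⟨y, fun h => ?_, hcl, relIndex_stabilizer_eq_two hx hFy.1 hFy.2, fun z hz v => ?_⟩
  · refine hFy.2 (hfix y ?_)
    rw [h]
    exact mem_orbitTypeStratum_self y
  · have hζz := hfix z hz
    have hζ2z : ζ ^ 2 • z = z := by rw [pow_two, mul_smul, hζz, hζz]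
    have hclosed : IsClosed {w : M | ζ ^ 2 • w = w} :=
      isClosed_eq (continuous_const_smul _) continuous_id
    have hA : ∀ w ∈ closure (orbitTypeStratum y : Set M), ζ ^ 2 • w = w := by
      refine fun w hw => closure_minimal (fun w hw => ?_) hclosed hw
      have h3 := stabilizer_eq_of_mem_orbitTypeStratum hw
      have h4 : ζ ^ 2 ∈ MulAction.stabilizer Circle y := hFy.1
      rw [← h3] at h4
      exact h4
    have hX : ∀ᶠ w in 𝓝 z, ζ • w = w → w ∈ orbitTypeStratum x := by
      refine eventually_smul_eq_imp_mem_orbitTypeStratum E hζ hz hζz ?_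
      filter_upwards [eventually_stabilizer_le_of_eq_zpowers E hζ (hst z hz)] with w hw hζw
      refine le_antisymm hw ?_
      rw [hst z hz, Subgroup.zpowers_le]
      exact hζw
    rw [mem_tangentTo_iff_isotropyEnd_eq hζ.pow hζ2z hA ?_, pow_two, isotropyEnd_mul hζz]
    · rfl
    · filter_upwards [hX, hR z hz] with w h1 h2 hw
      by_cases h : ζ • w = w
      · exact hcl (h1 h)
      · exact subset_closure (h2 ⟨hw, h⟩)

/-! ### Complex structures on normal bundles -/

open Polynomial in
theorem aeval_apply_eq_of_intertwine {V W : Type*} [AddCommGroup V] [Module ℝ V] [AddCommGroup W]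
    [Module ℝ W] {S : Module.End ℝ V} {T : Module.End ℝ W} {L : V →ₗ[ℝ] W}
    (h : ∀ v, T (L v) = L (S v)) (R : ℝ[X]) (v : V) : aeval T R (L v) = L (aeval S R v) := by
  induction R using Polynomial.induction_on' generalizing v with
  | add p q hp hq => simp only [map_add, LinearMap.add_apply, hp, hq]
  | monomial n a =>
    have hpow : ∀ (n : ℕ) (v : V), (T ^ n) (L v) = L ((S ^ n) v) := by
      intro n
      induction n with
      | zero => intro v; rfl
      | succ n ih => intro v; rw [pow_succ, pow_succ, Module.End.mul_apply, h, ih]; rfl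
    simp only [aeval_monomial, Module.End.mul_apply, Module.algebraMap_end_apply, hpow, map_smul]

section

variable {E : Type*} [NormedAddCommGroup E] [NormedSpace ℝ E]
  {M : Type*} [TopologicalSpace M] [ChartedSpace E M]

/-- The class in the normal space of a tangent vector, given as a vector of the model space `E`. -/
noncomputable def normalMk (A X : Set M) (z : M) (v : E) (hv : v ∈ tangentTo E A z) :
    NormalSpace E A X z :=
  Submodule.Quotient.mk ⟨v, hv⟩

variable {A B X : Set M} {z : M}

theorem exists_normalMk (n : NormalSpace E A X z) : ∃ v hv, n = normalMk A X z v hv := by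
  obtain ⟨⟨v, hv⟩, rfl⟩ := Submodule.Quotient.mk_surjective _ n
  exact ⟨v, hv, rfl⟩

theorem normalMk_eq_iff {v w : E} {hv : v ∈ tangentTo E A z} {hw : w ∈ tangentTo E A z} :
    normalMk A X z v hv = normalMk A X z w hw ↔ (v - w : E) ∈ tangentTo E X z :=
  Submodule.Quotient.eq _

theorem neg_normalMk {v : E} (hv : v ∈ tangentTo E A z) :
    -normalMk A X z v hv = normalMk A X z (-v) (neg_mem hv) := rfl

/-- The map of normal spaces induced by a linear map of tangent spaces. -/
noncomputable def normalMap (A B X : Set M) (z : M) (f : Module.End ℝ E)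
    (hAB : ∀ v : E, v ∈ tangentTo E A z → f v ∈ tangentTo E B z)
    (hX : ∀ v : E, v ∈ tangentTo E X z → f v ∈ tangentTo E X z) :
    NormalSpace E A X z →ₗ[ℝ] NormalSpace E B X z :=
  Submodule.mapQ _ _
    (LinearMap.restrict (show TangentSpace 𝓘(ℝ, E) z →ₗ[ℝ] TangentSpace 𝓘(ℝ, E) z from f) hAB)
    fun v hv => hX v.1 hv

theorem normalMap_normalMk (f : Module.End ℝ E)
    (hAB : ∀ v : E, v ∈ tangentTo E A z → f v ∈ tangentTo E B z)
    (hX : ∀ v : E, v ∈ tangentTo E X z → f v ∈ tangentTo E X z) (v : E)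
    (hv : v ∈ tangentTo E A z) :
    normalMap A B X z f hAB hX (normalMk A X z v hv) = normalMk B X z (f v) (hAB v hv) := rfl

end

section

variable {E : Type*} [NormedAddCommGroup E] [NormedSpace ℝ E]
  {M : Type*} [TopologicalSpace M] [ChartedSpace E M]
  [MulAction Circle M] [ContMDiffSMul (𝓡 1) 𝓘(ℝ, E) ∞ Circle M]

theorem isotropyEnd_mem_tangentTo (A : SubMulAction Circle M) (g : Circle) {z : M} {v : E}
    (hv : v ∈ tangentTo E (A : Set M) z) :
    isotropyEnd E g z v ∈ tangentTo E (A : Set M) (g • z) :=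
  tangentAction_mem E A g z v hv

theorem normalAction_normalMk (A X : SubMulAction Circle M) (g : Circle) (z : M) (v : E)
    (hv : v ∈ tangentTo E (A : Set M) z) :
    normalAction E A X g z (normalMk (E := E) (A : Set M) (X : Set M) z v hv) =
      normalMk (E := E) (A : Set M) (X : Set M) (g • z) (isotropyEnd E g z v)
        (isotropyEnd_mem_tangentTo A g hv) := rfl

theorem isotropyEnd_smul_comm {ζ : Circle} {z : M} (hz : ζ • z = z) (g : Circle) (v : E) :
    isotropyEnd E ζ (g • z) (isotropyEnd E g z v) = isotropyEnd E g z (isotropyEnd E ζ z v) := by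
  rw [← isotropyEnd_mul_apply, mul_comm, isotropyEnd_mul hz]
  rfl

variable [IsManifold 𝓘(ℝ, E) ∞ M]

open Polynomial in
/-- Polynomials in the isotropy endomorphism of `ζ` preserve the smoothness of vector fields along
sets of fixed points of `ζ`. -/
theorem contMDiffOn_aeval_isotropyEnd {ζ : Circle} {S : Set M} (hS : ∀ y ∈ S, ζ • y = y)
    {w : M → E}
    (hw : ContMDiffOn 𝓘(ℝ, E) 𝓘(ℝ, E).tangent ∞
      (fun y : M => (⟨y, w y⟩ : TangentBundle 𝓘(ℝ, E) M)) S) (R : ℝ[X]) :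
    ContMDiffOn 𝓘(ℝ, E) 𝓘(ℝ, E).tangent ∞
      (fun y : M => (⟨y, aeval (isotropyEnd E ζ y) R (w y)⟩ : TangentBundle 𝓘(ℝ, E) M)) S := by
  have step : ∀ u : M → E, ContMDiffOn 𝓘(ℝ, E) 𝓘(ℝ, E).tangent ∞
      (fun y : M => (⟨y, u y⟩ : TangentBundle 𝓘(ℝ, E) M)) S →
      ContMDiffOn 𝓘(ℝ, E) 𝓘(ℝ, E).tangent ∞
      (fun y : M => (⟨y, isotropyEnd E ζ y (u y)⟩ : TangentBundle 𝓘(ℝ, E) M)) S := by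
    intro u hu
    have h1 := (contMDiff_smul_left E (M := M) ζ).contMDiff_tangentMap (m := ∞) le_rfl
    refine (h1.comp_contMDiffOn hu).congr fun y hy => ?_
    have h2 : ∀ a b : M, a = b → ∀ v : E,
        (⟨a, v⟩ : TangentBundle 𝓘(ℝ, E) M) = ⟨b, v⟩ := by rintro a _ rfl v; rfl
    exact h2 y (ζ • y) (hS y hy).symm _
  induction R using Polynomial.induction_on with
  | C a =>
    simp only [aeval_C, Module.algebraMap_end_apply]
    exact ContMDiffOn.const_smul_section (a := a) hw
  | add p q hp hq =>
    simp only [map_add, LinearMap.add_apply]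
    exact ContMDiffOn.add_section hp hq
  | monomial n a h =>
    refine (step _ h).congr fun y _ => ?_
    have : aeval (isotropyEnd E ζ y) (C a * X ^ (n + 1)) (w y) =
        isotropyEnd E ζ y (aeval (isotropyEnd E ζ y) (C a * X ^ n) (w y)) := by
      rw [pow_succ, ← mul_assoc, mul_comm, map_mul, aeval_X]
      rfl
    rw [this]

/-- The normal bundle of `X` in itself is zero, so it has a complex structure. -/
theorem nonempty_equivariantComplexStructure_self (X : SubMulAction Circle M) :
    Nonempty (EquivariantComplexStructure E X X) := by
  have hsub : ∀ z (n m : NormalSpace E (X : Set M) (X : Set M) z), n = m := by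
    intro z n m
    obtain ⟨v, hv, rfl⟩ := exists_normalMk n
    obtain ⟨w, hw, rfl⟩ := exists_normalMk m
    exact normalMk_eq_iff.2 (sub_mem hv hw)
  refine ⟨⟨fun _ => 0, fun _ _ _ => hsub _ _ _, fun O _ s hs => ?_, fun _ _ _ _ => hsub _ _ _⟩⟩
  convert hs using 2
  exact hsub _ _ _

end

section

variable {E : Type*} [NormedAddCommGroup E] [NormedSpace ℝ E] [FiniteDimensional ℝ E]
  {M : Type*} [TopologicalSpace M] [ChartedSpace E M] [IsManifold 𝓘(ℝ, E) ∞ M]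
  [MulAction Circle M] [ContMDiffSMul (𝓡 1) 𝓘(ℝ, E) ∞ Circle M]

open Polynomial in
/-- A complex structure on the part of the normal bundle of `X` where `ζ` acts by `-1` extends to
the whole normal bundle: on the other eigenspaces, a polynomial in the isotropy endomorphism of `ζ`
is a complex structure. -/
theorem nonempty_equivariantComplexStructure_top {ζ : Circle} (hζ : IsOfFinOrder ζ)
    {X B : SubMulAction Circle M} (hX : ∀ z ∈ X, ζ • z = z)
    (hTX : ∀ z ∈ X, ∀ v : E, v ∈ tangentTo E (X : Set M) z ↔ isotropyEnd E ζ z v = v)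
    (hTB : ∀ z ∈ X, ∀ v : E, v ∈ tangentTo E (B : Set M) z ↔
      isotropyEnd E ζ z (isotropyEnd E ζ z v) = v)
    (J' : EquivariantComplexStructure E B X) :
    Nonempty (EquivariantComplexStructure E (⊤ : SubMulAction Circle M) X) := by
  classical
  obtain ⟨n, hn, hζn⟩ := isOfFinOrder_iff_pow_eq_one.1 hζ
  obtain ⟨P, Q, hPQ⟩ := exists_complexStructure_polynomials hn
  let T : M → Module.End ℝ E := fun z => isotropyEnd E ζ z
  let p : M → Module.End ℝ E := fun z => aeval (T z) P
  let q : M → Module.End ℝ E := fun z => aeval (T z) Q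
  have htop : ∀ z (v : E), v ∈ tangentTo E ((⊤ : SubMulAction Circle M) : Set M) z := by
    intro z v
    exact Submodule.eq_top_iff'.1 (tangentTo_univ (E := E) z) v
  have hPQz : ∀ z ∈ X, (∀ v, T z (p z (p z v) + v - q z v) = p z (p z v) + v - q z v) ∧
      (∀ v, T z (q z v) = -q z v) ∧ (∀ v, q z (p z v) = 0) ∧
      (∀ v, T z (T z v) = v → p z v = 0) ∧
      (∀ v, T z (T z v) = v → T z (q z v - v) = q z v - v) := by
    intro z hz
    refine hPQ (T z) ?_
    rw [← isotropyEnd_pow (hX z hz), hζn, isotropyEnd_one]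
  have hcomm : ∀ z, ∀ R : ℝ[X], ∀ v, T z (aeval (T z) R v) = aeval (T z) R (T z v) :=
    fun z R v => (aeval_apply_eq_of_intertwine (L := T z) (fun _ => rfl) R v).symm
  have hpX : ∀ z ∈ X, ∀ v : E, v ∈ tangentTo E (X : Set M) z → p z v ∈ tangentTo E (X : Set M) z :=
    fun z hz v hv => by
      rw [hTX z hz] at hv ⊢
      exact (hcomm z P v).trans (congrArg (p z) hv)
  have hqX : ∀ z ∈ X, ∀ v : E, v ∈ tangentTo E (X : Set M) z → q z v ∈ tangentTo E (X : Set M) z :=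
    fun z hz v hv => by
      rw [hTX z hz] at hv ⊢
      exact (hcomm z Q v).trans (congrArg (q z) hv)
  have hqB : ∀ z ∈ X, ∀ v : E, q z v ∈ tangentTo E (B : Set M) z := fun z hz v => by
    rw [hTB z hz]
    have := (hPQz z hz).2.1 v
    change T z (T z (q z v)) = q z v
    rw [this, map_neg, this, neg_neg]
  let qbar : ∀ z ∈ X, NormalSpace E ((⊤ : SubMulAction Circle M) : Set M) (X : Set M) z →ₗ[ℝ]
      NormalSpace E (B : Set M) (X : Set M) z := fun z hz =>
    normalMap _ _ _ z (q z) (fun v _ => hqB z hz v) (hqX z hz)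
  let J : ∀ z : M, Module.End ℝ
      (NormalSpace E ((⊤ : SubMulAction Circle M) : Set M) (X : Set M) z) := fun z =>
    if hz : z ∈ X then
      normalMap _ _ _ z (p z) (fun v _ => htop z _) (hpX z hz) +
        (normalMap (B : Set M) _ _ z 1 (fun v _ => htop z _) (fun v hv => hv)).comp
          ((J'.J z).comp (qbar z hz))
    else 0
  -- `J` sends the class of `v` to the class of `p v + b`, where `b` represents `J' [q v]`
  have hJ : ∀ z (hz : z ∈ X), ∀ v b : E, ∀ hb : b ∈ tangentTo E (B : Set M) z,
      ∀ hv : v ∈ tangentTo E ((⊤ : SubMulAction Circle M) : Set M) z,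
      J'.J z (normalMk _ _ z (q z v) (hqB z hz v)) = normalMk _ _ z b hb →
      J z (normalMk _ _ z v hv) = normalMk _ _ z (p z v + b) (htop z _) := by
    intro z hz v b hb hv h
    simp only [J, dif_pos hz, LinearMap.add_apply, LinearMap.comp_apply, qbar, normalMap_normalMk,
      h]
    rfl
  refine ⟨⟨J, ?_, ?_, ?_⟩⟩
  · intro z hz m
    obtain ⟨v, hv, rfl⟩ := exists_normalMk m
    obtain ⟨h1, h2, h3, h4, h5⟩ := hPQz z hz
    obtain ⟨b, hb, hab⟩ := exists_normalMk (J'.J z (normalMk _ _ z (q z v) (hqB z hz v)))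
    have hb' : T z (T z b) = b := (hTB z hz b).1 hb
    have hqb : normalMk (B : Set M) (X : Set M) z (q z (p z v + b)) (hqB z hz _) =
        normalMk (B : Set M) (X : Set M) z b hb := by
      refine normalMk_eq_iff.2 ((hTX z hz _).2 ?_)
      rw [map_add, h3, zero_add]
      exact h5 b hb'
    rw [hJ z hz v b hb hv hab, hJ z hz (p z v + b) (-(q z v)) (neg_mem (hqB z hz v)) (htop z _) ?_,
      neg_normalMk, normalMk_eq_iff, hTX z hz]
    · rw [map_add, h4 b hb', add_zero]
      have := h1 v
      rwa [show p z (p z v) + v - q z v = p z (p z v) + -q z v - -v by abel] at this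
    · rw [hqb, ← hab, J'.sq_eq z hz]
      rfl
  · intro O hO s hs
    let s' : ∀ z : M, NormalSpace E (B : Set M) (X : Set M) z := fun z =>
      if hz : z ∈ X then qbar z hz (s z) else 0
    have hs' : IsSmoothNormalSectionOn E (B : Set M) (X : Set M) O s' := by
      intro x hx
      obtain ⟨O', hO', hxO', w, hw, hsw⟩ := hs x hx
      let w' : ∀ y : M, tangentTo E (B : Set M) y := fun y =>
        if hy : y ∈ X then ⟨q y (w y).1, hqB y hy _⟩ else 0
      have hw' : ∀ y (hy : y ∈ X), w' y = ⟨q y (w y).1, hqB y hy _⟩ := fun y hy => dif_pos hy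
      refine ⟨O', hO', hxO', w', ?_, ?_⟩
      · refine (contMDiffOn_aeval_isotropyEnd (ζ := ζ) (w := fun y => (w y).1)
          (fun y hy => hX y hy.1) hw Q).congr fun y hy => ?_
        have hyX : y ∈ X := hy.1
        rw [hw' y hyX]
      · intro y hy
        have hyX : y ∈ X := hy.1
        rw [hw' y hyX]
        simp only [s', dif_pos hyX, hsw y hy]
        rfl
    intro x hx
    obtain ⟨O₁, hO₁, hxO₁, w, hw, hsw⟩ := hs x hx
    obtain ⟨O₂, hO₂, hxO₂, u, hu, hsu⟩ := J'.smooth O hO s' hs' x hx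
    let uE : M → E := fun y => (u y).1
    refine ⟨O₁ ∩ O₂, hO₁.inter hO₂, ⟨hxO₁, hxO₂⟩,
      fun y => ⟨p y (w y).1 + uE y, htop y _⟩, ?_, ?_⟩
    · have hw' := contMDiffOn_aeval_isotropyEnd (ζ := ζ) (w := fun y => (w y).1)
        (fun y hy => hX y hy.1) hw P
      exact ContMDiffOn.add_section
        (hw'.mono (Set.inter_subset_inter_right _ Set.inter_subset_left))
        (hu.mono (Set.inter_subset_inter_right _ Set.inter_subset_right))
    · intro y hy
      have hyX : y ∈ X := hy.1
      have e1 := hsw y ⟨hy.1, hy.2.1⟩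
      have e2 := hsu y ⟨hy.1, hy.2.2⟩
      simp only [s', dif_pos hyX, e1] at e2
      refine (congrArg (J y) e1).trans ?_
      exact hJ y hyX (w y).1 (u y).1 (u y).2 (w y).2 e2
  · intro g z hz m
    obtain ⟨v, hv, rfl⟩ := exists_normalMk m
    obtain ⟨b, hb, hab⟩ := exists_normalMk (J'.J z (normalMk _ _ z (q z v) (hqB z hz v)))
    have hgz : g • z ∈ X := X.smul_mem g hz
    have hint : ∀ R : ℝ[X], ∀ v : E, aeval (T (g • z)) R (isotropyEnd E g z v) =
        isotropyEnd E g z (aeval (T z) R v) :=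
      aeval_apply_eq_of_intertwine (isotropyEnd_smul_comm (hX z hz) g)
    rw [hJ z hz v b hb hv hab, normalAction_normalMk, normalAction_normalMk,
      hJ (g • z) hgz _ (isotropyEnd E g z b) (isotropyEnd_mem_tangentTo B g hb) _ ?_]
    · refine normalMk_eq_iff.2 ?_
      rw [map_add, ← hint P v]
      exact (sub_self (_ : E)) ▸ zero_mem _
    · have e1 := J'.equivariant g z hz (normalMk _ _ z (q z v) (hqB z hz v))
      rw [hab, normalAction_normalMk, normalAction_normalMk] at e1
      rw [← e1]
      congr 1
      refine normalMk_eq_iff.2 ?_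
      have e2 : q (g • z) (isotropyEnd E g z v) = isotropyEnd E g z (q z v) := hint Q v
      rw [e2]
      exact (sub_self (_ : E)) ▸ zero_mem _

end

end CircleManifold

theorem mainTheorem6
    {E : Type*} [NormedAddCommGroup E] [NormedSpace ℝ E] [FiniteDimensional ℝ E]
    {M : Type*} [TopologicalSpace M] [T2Space M] [SecondCountableTopology M]
    [ChartedSpace E M] [IsManifold 𝓘(ℝ, E) ∞ M]
    [MulAction Circle M] [ContinuousSMul Circle M]
    [ContMDiffSMul (𝓡 1) 𝓘(ℝ, E) ∞ Circle M]
    (h : CircleManifold.ConditionRestriction E M) :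
    CircleManifold.ConditionBundleComplex E M := by
  open CircleManifold in
  intro x
  obtain ⟨ζ, hζ, hζx, hTX, hst⟩ := exists_isOfFinOrder_forall_mem_tangentTo_iff E x
  have hX : ∀ z ∈ orbitTypeStratum x, ζ • z = z := fun z hz => by
    rw [← MulAction.mem_stabilizer_iff, stabilizer_eq_of_mem_orbitTypeStratum hz]
    exact hζx
  by_cases hne : (isotropyEnd E ζ x).eigenspace (-1) = ⊥
  -- without the eigenvalue `-1`, the fixed spaces of `ζ` and of `ζ ^ 2` agree along the stratum
  · obtain ⟨J'⟩ := nonempty_equivariantComplexStructure_self (E := E) (orbitTypeStratum x)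
    refine nonempty_equivariantComplexStructure_top hζ hX hTX (fun z hz v => ?_) J'
    rw [hTX z hz]
    refine ⟨fun hv => by rw [hv, hv], fun hv => ?_⟩
    have hbot : (isotropyEnd E ζ z).eigenspace (-1) = ⊥ := by
      rw [← Submodule.finrank_eq_zero, ← finrank_eigenspace_eq_of_isPreconnected hζ
        (isPreconnected_orbitTypeStratum x) hX (-1) (mem_orbitTypeStratum_self x) hz, hne,
        finrank_bot]
    have hmem : isotropyEnd E ζ z v - v ∈ (isotropyEnd E ζ z).eigenspace (-1) := by
      rw [Module.End.mem_eigenspace_iff, map_sub, hv, neg_one_smul, neg_sub]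
    rw [hbot, Submodule.mem_bot, sub_eq_zero] at hmem
    exact hmem
  · rcases hst with hst | hodd
    · obtain ⟨y, hne', hcl, hidx, hTB⟩ := exists_stratum_of_index_two E hζ hst hne
      obtain ⟨J'⟩ := h x y hne' hcl hidx
      have hTB' : ∀ z ∈ orbitTypeStratum x, ∀ v : E,
          v ∈ tangentTo E ((invClosure (orbitTypeStratum y) : SubMulAction Circle M) : Set M) z ↔
            isotropyEnd E ζ z (isotropyEnd E ζ z v) = v := hTB
      exact nonempty_equivariantComplexStructure_top hζ hX hTX hTB' J'
    · -- an endomorphism of odd order does not have the eigenvalue `-1`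
      exfalso
      obtain ⟨v, hv, hv0⟩ := (Submodule.ne_bot_iff _).1 hne
      rw [Module.End.mem_eigenspace_iff, neg_one_smul] at hv
      have h1 : isotropyEnd E ζ x ^ orderOf ζ = 1 := by
        rw [← isotropyEnd_pow hζx, pow_orderOf_eq_one, isotropyEnd_one]
      have h2 : ∀ k : ℕ, (isotropyEnd E ζ x ^ k) v = (-1 : ℝ) ^ k • v := fun k => by
        induction k with
        | zero => simp
        | succ k ih => rw [pow_succ, Module.End.mul_apply, hv, map_neg, ih, pow_succ]; simp
      have h3 := h2 (orderOf ζ)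
      rw [h1, hodd.neg_one_pow, Module.End.one_apply, neg_one_smul] at h3
      have h4 : (2 : ℝ) • v = 0 := by
        rw [two_smul]
        nth_rewrite 1 [h3]
        exact neg_add_cancel v
      exact hv0 ((smul_eq_zero.1 h4).resolve_left two_ne_zero)
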